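/- Let $V$ be a vector space of finite dimension $n$ over a field of characteristic $\neq 2$, and let $\xi$ be a nondegenerate symplectic (alternating) bilinear form on $V$. Write $U\perp W$ if $\xi(u,w)=0$ for all $u\in U$, $w\in W$, and $\mathrm{Rad}(U)=U\cap U^\perp$. A subspace $U$ is regular if $\mathrm{Rad}(U)=0$ and tangential if $\dim \mathrm{Rad}(U)=1$. The projective symplectic geometry $(\mathfrak P,\perp)$ consists of the points (1-dimensional subspaces) and lines (2-dimensional subspaces) of $V$ with inclusion and with the relation $\perp$; its automorphisms are the collineations that preserve $\perp$ in both directions. Let $\mathbf T_k$ be the set of tangential $k$-dimensional subspaces. For $U,W\in\mathbf T_k$ write $U\sim_- W$ if $U\cap W$ is a regular subspace of dimension $k-1$, and $U\sim^+ W$ if $U\neq W$ and $U,W$ lie in a common regular subspace of dimension $k+1$. Let $k$ be odd with $1\le k\le n-1$. (1) If $k\neq 1$, then $(\mathfrak P,\perp)$ is definable in $\langle \mathbf T_k,\sim_-\rangle$. If $k\neq n-1$, then $(\mathfrak P,\perp)$ is definable in $\langle\mathbf T_k,\sim^+\rangle$. Here definable means first-order interpretable without parameters: the points and the lines of $\mathfrak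 P$ can be coded by the tuples, of some fixed lengths, in parameter-free first-order definable sets of tuples of elements of $\mathbf T_k$ (each point and each line having at least one code), in such a way that the equality of coded points, the equality of coded lines, the incidence of points with lines, the orthogonality $\perp$ of points and lines, and the relation "the coded point is contained in $U$" for $U\in\mathbf T_k$ are all first-order definable without parameters. (2) If $k\neq 1$, then every bijection $f$ of $\mathbf T_k$ with $f(U)\sim_- f(W)\iff U\sim_- W$ for all $U,W\in\mathbf T_k$ is induced by an automorphism of $(\mathfrak P,\perp)$. If $k\neq n-1$, then every bijection $f$ of $\mathbf T_k$ with $f(U)\sim^+ f(W)\iff U\sim^+ W$ for all $U,W\in\mathbf T_k$ is induced by an automorphism of $(\mathfrak P,\perp)$. (An automorphism $\varphi$ induces $f$ if the points of $f(U)$ are exactly the images under $\varphi$ of the points of $U$, for all $U\in\mathbf T_k$.) -/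

import Mathlib

open Module

namespace SympGeom

/-! ### First-order definability from one binary relation -/

section Definability

variable {M X Y : Type*}

/-- The first-order structure `⟨M, r⟩` with one binary relation. -/
@[reducible]
def relStructure (r : M → M → Prop) : FirstOrder.Language.graph.Structure M where
  RelMap | .adj => fun x => r (x 0) (x 1)

/-- `s ⊆ M ^ α` is first-order definable, without parameters, in the structure `⟨M, r⟩`. -/
def DefinableIn (r : M → M → Prop) {α : Type} (s : Set (α → M)) : Prop :=
  letI := relStructure r
  (∅ : Set M).Definable FirstOrder.Language.graph s

/-- A coding of the objects of `X` by tuples of elements of `M`: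
the tuples in `dom` are codes, each code names one object, and each object is named. -/
structure Coding (M X : Type*) where
  /-- the length of the codes -/
  arity : ℕ
  /-- the set of codes -/
  dom : Set (Fin arity → M)
  /-- the object with a given code -/
  decode : dom → X
  /-- every object has a code -/
  surj : Function.Surjective decode

/-- The trivial coding of the elements of `M` by themselves. -/
def Coding.self (M : Type*) : Coding M M where
  arity := 1
  dom := Set.univ
  decode x := x.1 0
  surj m := ⟨⟨fun _ => m, trivial⟩, rfl⟩

/-- The relation `R` between coded objects, read as a relation between their codes,
is first-order definable, without parameters, in `⟨M, r⟩`. -/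
def CodedDefinable (r : M → M → Prop) (c : Coding M X) (d : Coding M Y)
    (R : X → Y → Prop) : Prop :=
  DefinableIn r {z : Fin c.arity ⊕ Fin d.arity → M |
    ∃ (h : (fun i => z (Sum.inl i)) ∈ c.dom) (h' : (fun j => z (Sum.inr j)) ∈ d.dom),
      R (c.decode ⟨_, h⟩) (d.decode ⟨_, h'⟩)}

end Definability

/-! ### Symplectic projective geometry -/

variable {F V : Type*} [Field F] [AddCommGroup V] [Module F V]

/-- The radical `U ∩ U^⊥` of a subspace `U`. -/
def rad (ξ : LinearMap.BilinForm F V) (U : Submodule F V) : Submodule F V :=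
  U ⊓ ξ.orthogonal U

/-- `U` is regular: its radical is the zero subspace. -/
def IsRegular (ξ : LinearMap.BilinForm F V) (U : Submodule F V) : Prop :=
  rad ξ U = ⊥

/-- `U` is tangential: its radical is a projective point. -/
def IsTangential (ξ : LinearMap.BilinForm F V) (U : Submodule F V) : Prop :=
  finrank F (rad ξ U) = 1

/-- `U ⊥ W`. -/
def Perp (ξ : LinearMap.BilinForm F V) (U W : Submodule F V) : Prop :=
  ∀ u ∈ U, ∀ w ∈ W, ξ u w = 0

variable (F V) in
/-- The subspaces of (linear) dimension `j`. -/
abbrev Sub (j : ℕ) : Type _ := {U : Submodule F V // finrank F U = j}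

variable (F V) in
/-- The points of the projective space over `V`. -/
abbrev Point : Type _ := Sub F V 1

variable (F V) in
/-- The lines of the projective space over `V`. -/
abbrev Line : Type _ := Sub F V 2

/-- The tangential `k`-subspaces. -/
abbrev Tang (ξ : LinearMap.BilinForm F V) (k : ℕ) : Type _ :=
  {U : Submodule F V // finrank F U = k ∧ IsTangential ξ U}

/-- `U ∩ W` is a regular `(k - 1)`-subspace. -/
def BotAdj (ξ : LinearMap.BilinForm F V) (k : ℕ) (U W : Tang ξ k) : Prop :=
  finrank F (U.1 ⊓ W.1 : Submodule F V) + 1 = k ∧ IsRegular ξ (U.1 ⊓ W.1)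

/-- `U ≠ W`, and `U`, `W` lie in a common regular `(k + 1)`-subspace. -/
def TopAdj (ξ : LinearMap.BilinForm F V) (k : ℕ) (U W : Tang ξ k) : Prop :=
  U ≠ W ∧ ∃ B : Submodule F V, finrank F B = k + 1 ∧ IsRegular ξ B ∧ U.1 ≤ B ∧ W.1 ≤ B

/-- The symplectic projective geometry of `(V, ξ)` -- points, lines, incidence and
orthogonality -- is first-order definable, without parameters, in `⟨T_k, r⟩`: points and lines
are coded by tuples of tangential `k`-subspaces so that equality of the coded objects, the
incidence of points with lines and all orthogonalities are definable. The codes name the points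
of the *underlying* geometry: that a coded point lies in a given tangential `k`-subspace is
definable too. -/
def DefinesGeometry (ξ : LinearMap.BilinForm F V) (k : ℕ)
    (r : Tang ξ k → Tang ξ k → Prop) : Prop :=
  ∃ (P : Coding (Tang ξ k) (Point F V)) (L : Coding (Tang ξ k) (Line F V)),
    DefinableIn r P.dom ∧ DefinableIn r L.dom ∧
    CodedDefinable r P P (fun p q => p = q) ∧
    CodedDefinable r L L (fun l m => l = m) ∧
    CodedDefinable r P L (fun p l => p.1 ≤ l.1) ∧
    CodedDefinable r P P (fun p q => Perp ξ p.1 q.1) ∧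
    CodedDefinable r P L (fun p l => Perp ξ p.1 l.1) ∧
    CodedDefinable r L L (fun l m => Perp ξ l.1 m.1) ∧
    CodedDefinable r P (Coding.self (Tang ξ k)) (fun p U => p.1 ≤ U.1)

/-- An automorphism of the symplectic projective geometry: a collineation (a bijection of
the points with a bijection of the lines, preserving and reflecting incidence) which preserves
and reflects the orthogonality of points, of points and lines, and of lines. -/
structure GeomAut (ξ : LinearMap.BilinForm F V) where
  /-- the action on points -/
  onPoint : Point F V ≃ Point F V
  /-- the action on lines -/
  onLine : Line F V ≃ Line F V
  incid : ∀ p l, (onPoint p).1 ≤ (onLine l).1 ↔ p.1 ≤ l.1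
  perp_pp : ∀ p q, Perp ξ (onPoint p).1 (onPoint q).1 ↔ Perp ξ p.1 q.1
  perp_pl : ∀ p l, Perp ξ (onPoint p).1 (onLine l).1 ↔ Perp ξ p.1 l.1
  perp_ll : ∀ l m, Perp ξ (onLine l).1 (onLine m).1 ↔ Perp ξ l.1 m.1

/-- The map `f` on tangential `k`-subspaces is determined (induced) by the automorphism `φ`:
the points of `f U` are the images of the points of `U`. -/
def GeomAut.Induces {ξ : LinearMap.BilinForm F V} {k : ℕ} (φ : GeomAut ξ)
    (f : Tang ξ k → Tang ξ k) : Prop :=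
  ∀ (U : Tang ξ k) (p : Point F V), (φ.onPoint p).1 ≤ (f U).1 ↔ p.1 ≤ U.1

end SympGeom

/-!
Every point is the radical of some tangential `k`-subspace, because `k` is odd and `k < n`. So it
is enough to define, from `∼₋`, the relations `rad U ⊥ rad W` and `rad U ⊥ W`: equality of points,
collinearity and containment are then read off from orthogonality, since `S ≤ T` means that every
point orthogonal to `T` is orthogonal to `S`.

A triangle `U, W, Z` of `∼₋` satisfies `U ⊓ W ≤ Z` or `Z ≤ U ⊔ W`. All common neighbours of a
triangle that is not of the second kind contain `U ⊓ W`, so they are pairwise adjacent; for a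
triangle of the second kind, shears of `U ⊓ W` along a radical give two that are not, provided
`2 ≠ 0`. This defines the triangles of the second kind. For `U ∼₋ W`, the radicals of `U` and `W`
are orthogonal exactly when non-adjacency is transitive on the third vertices of these triangles,
and then non-adjacent third vertices have the same radical. Transvections fixing a point connect
any two tangential subspaces with that radical by at most `2k` steps of this kind, so equality of
radicals is definable, and both orthogonality relations follow.

Taking orthogonal complements keeps radicals and exchanges `∼⁺` in dimension `k` with `∼₋` in
dimension `n - k`. Finally, a bijection preserving the adjacency preserves every definable
relation between codes, so it acts on the coded points and lines.
-/

namespace SympGeom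

/-! ### Definable predicates and relations -/

section Definability

variable {M X Y : Type*} {r : M → M → Prop} {ι : Type}

/-- The predicate `P` on tuples of elements of `M` is first-order definable in `⟨M, r⟩`: the form
of `DefinableIn` to which the connectives and quantifiers are applied one by one. -/
def DefinablePred (r : M → M → Prop) (P : (ι → M) → Prop) : Prop :=
  DefinableIn r {v | P v}

/-- The binary relation `R` on `M` is first-order definable in `⟨M, r⟩`. -/
def DefinableRel (r R : M → M → Prop) : Prop :=
  DefinablePred r fun v : Fin 2 → M => R (v 0) (v 1)

theorem DefinableIn.univ : DefinableIn r (Set.univ : Set (ι → M)) :=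
  let := relStructure r
  Set.definable_univ

theorem DefinablePred.congr {P Q : (ι → M) → Prop} (e : ∀ v, Q v ↔ P v)
    (h : DefinablePred r P) : DefinablePred r Q :=
  (funext fun v => propext (e v) : Q = P) ▸ h

theorem DefinablePred.and {P Q : (ι → M) → Prop} (hP : DefinablePred r P)
    (hQ : DefinablePred r Q) : DefinablePred r fun v => P v ∧ Q v :=
  let := relStructure r
  Set.Definable.inter hP hQ

theorem DefinablePred.or {P Q : (ι → M) → Prop} (hP : DefinablePred r P)
    (hQ : DefinablePred r Q) : DefinablePred r fun v => P v ∨ Q v :=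
  let := relStructure r
  Set.Definable.union hP hQ

theorem DefinablePred.not {P : (ι → M) → Prop} (hP : DefinablePred r P) :
    DefinablePred r fun v => ¬ P v :=
  let := relStructure r
  Set.Definable.compl hP

theorem DefinablePred.imp {P Q : (ι → M) → Prop} (hP : DefinablePred r P)
    (hQ : DefinablePred r Q) : DefinablePred r fun v => P v → Q v :=
  (hP.not.or hQ).congr fun _ => imp_iff_not_or

theorem DefinablePred.ex {P : (ι → M) → M → Prop}
    (hP : DefinablePred r fun v : ι ⊕ Fin 1 → M => P (fun i => v (.inl i)) (v (.inr 0))) :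
    DefinablePred r fun v => ∃ m, P v m := by
  let := relStructure r
  exact DefinablePred.congr (P := fun v => ∃ w : Fin 1 → M, P v (w 0))
    (fun v => ⟨fun ⟨m, h⟩ => ⟨fun _ => m, h⟩, fun ⟨w, h⟩ => ⟨_, h⟩⟩)
    (Set.Definable.exists_of_finite (β := Fin 1) hP)

theorem DefinablePred.all {P : (ι → M) → M → Prop}
    (hP : DefinablePred r fun v : ι ⊕ Fin 1 → M => P (fun i => v (.inl i)) (v (.inr 0))) :
    DefinablePred r fun v => ∀ m, P v m :=
  (DefinablePred.ex (P := fun v m => ¬ P v m) hP.not).not.congr fun _ => not_exists_not.symm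

theorem DefinableRel.congr {R S : M → M → Prop} (e : ∀ a b, S a b ↔ R a b)
    (h : DefinableRel r R) : DefinableRel r S :=
  DefinablePred.congr (fun _ => e _ _) h

theorem DefinableRel.app {R : M → M → Prop} (h : DefinableRel r R) (i j : ι) :
    DefinablePred r fun v : ι → M => R (v i) (v j) :=
  let := relStructure r
  Set.Definable.preimage_comp (![i, j] : Fin 2 → ι) h

theorem DefinableRel.self : DefinableRel r r := by
  let := relStructure r
  refine Set.empty_definable_iff.2
    ⟨FirstOrder.Language.adj.formula₂ (FirstOrder.Language.Term.var 0)
      (FirstOrder.Language.Term.var 1), ?_⟩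
  ext v
  simp [FirstOrder.Language.Formula.realize_rel₂, FirstOrder.Language.Structure.RelMap]

theorem DefinableRel.eq : DefinableRel r Eq := by
  let := relStructure r
  refine Set.empty_definable_iff.2
    ⟨FirstOrder.Language.Term.equal (FirstOrder.Language.Term.var 0)
      (FirstOrder.Language.Term.var 1), ?_⟩
  ext v
  simp

theorem DefinableRel.comp {R S : M → M → Prop} (hR : DefinableRel r R) (hS : DefinableRel r S) :
    DefinableRel r (Relation.Comp R S) :=
  .ex <| (hR.app _ _).and (hS.app _ _)

theorem DefinableRel.iterate_comp {R : M → M → Prop} (hR : DefinableRel r R) (n : ℕ) :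
    DefinableRel r ((Relation.Comp R)^[n] Eq) := by
  induction n with
  | zero => exact .eq
  | succ n ih =>
    rw [Function.iterate_succ_apply']
    exact hR.comp ih

theorem CodedDefinable.of_pred {c : Coding M X} {d : Coding M Y} {R : X → Y → Prop}
    (hc : DefinableIn r c.dom) (hd : DefinableIn r d.dom)
    {Q : (Fin c.arity ⊕ Fin d.arity → M) → Prop}
    (hQ : DefinablePred r Q)
    (h : ∀ x y, R (c.decode x) (d.decode y) ↔ Q (Sum.elim x.1 y.1)) : CodedDefinable r c d R := by
  let := relStructure r
  have hc' : DefinablePred r fun z : Fin c.arity ⊕ Fin d.arity → M => z ∘ Sum.inl ∈ c.dom :=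
    Set.Definable.preimage_comp Sum.inl hc
  have hd' : DefinablePred r fun z : Fin c.arity ⊕ Fin d.arity → M => z ∘ Sum.inr ∈ d.dom :=
    Set.Definable.preimage_comp Sum.inr hd
  refine ((hc'.and hd').and hQ).congr fun z => ⟨fun ⟨h₁, h₂, h₃⟩ => ⟨⟨h₁, h₂⟩, ?_⟩,
    fun ⟨⟨h₁, h₂⟩, h₃⟩ => ⟨h₁, h₂, ?_⟩⟩
  · exact Sum.elim_comp_inl_inr z ▸ (h ⟨_, h₁⟩ ⟨_, h₂⟩).1 h₃
  · exact (h ⟨_, h₁⟩ ⟨_, h₂⟩).2 ((Sum.elim_comp_inl_inr z).symm ▸ h₃)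

end Definability

/-! ### Isomorphisms and definability -/

section Isomorphisms

variable {M N X Y : Type*} {r : M → M → Prop} {s : N → N → Prop} {ι : Type}

/-- An isomorphism of relations as an isomorphism of the first-order structures `⟨M, r⟩` and
`⟨N, s⟩`, in the form in which formulas can be transported along it. -/
def relEquiv (e : r ≃r s) :
    letI := relStructure r
    letI := relStructure s
    FirstOrder.Language.graph.Equiv M N :=
  letI := relStructure r
  letI := relStructure s
  { e.toEquiv with
    map_fun' := fun f => nomatch f
    map_rel' := by
      rintro _ ⟨⟩ x
      exact e.map_rel_iff }

theorem DefinableIn.preimage (e : r ≃r s) {S : Set (ι → N)} (h : DefinableIn s S) :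
    DefinableIn r {v | e ∘ v ∈ S} := by
  let := relStructure r
  let := relStructure s
  obtain ⟨φ, rfl⟩ := Set.empty_definable_iff.1 h
  refine Set.empty_definable_iff.2 ⟨φ, ?_⟩
  ext v
  exact FirstOrder.Language.StrongHomClass.realize_formula (relEquiv e) φ

theorem DefinableIn.comp_mem_iff (e : r ≃r r) {S : Set (ι → M)} (h : DefinableIn r S)
    (v : ι → M) : e ∘ v ∈ S ↔ v ∈ S := by
  let := relStructure r
  obtain ⟨φ, rfl⟩ := Set.empty_definable_iff.1 h
  exact FirstOrder.Language.StrongHomClass.realize_formula (relEquiv e) φ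

theorem DefinableRel.preimage (e : r ≃r s) {S : N → N → Prop} (h : DefinableRel s S) :
    DefinableRel r (e ⁻¹'o S) :=
  DefinableIn.preimage e h

theorem CodedDefinable.map_iff {c : Coding M X} {d : Coding M Y} {R : X → Y → Prop}
    (h : CodedDefinable r c d R) (e : r ≃r r) (x : c.dom) (y : d.dom)
    (hx : e ∘ x.1 ∈ c.dom) (hy : e ∘ y.1 ∈ d.dom) :
    R (c.decode ⟨_, hx⟩) (d.decode ⟨_, hy⟩) ↔ R (c.decode x) (d.decode y) := by
  have := DefinableIn.comp_mem_iff e h (Sum.elim x.1 y.1)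
  exact ⟨fun H => (this.1 ⟨hx, hy, H⟩).2.2, fun H => (this.2 ⟨x.2, y.2, H⟩).2.2⟩

theorem Coding.exists_map {c : Coding M X} (hd : DefinableIn r c.dom)
    (heq : CodedDefinable r c c Eq) (e : r ≃r r) :
    ∃ σ : X → X, ∀ x : c.dom, ∃ hx : e ∘ x.1 ∈ c.dom, σ (c.decode x) = c.decode ⟨_, hx⟩ := by
  have mem (x : c.dom) : e ∘ x.1 ∈ c.dom := (hd.comp_mem_iff e x.1).2 x.2
  refine ⟨fun a => c.decode ⟨_, mem (Function.surjInv c.surj a)⟩, fun x => ⟨mem x, ?_⟩⟩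
  exact (heq.map_iff e _ x (mem _) (mem x)).2 (Function.surjInv_eq c.surj _)

theorem Coding.exists_perm {c : Coding M X} (hd : DefinableIn r c.dom)
    (heq : CodedDefinable r c c Eq) (e : r ≃r r) :
    ∃ σ : X ≃ X, ∀ x : c.dom, ∃ hx : e ∘ x.1 ∈ c.dom, σ (c.decode x) = c.decode ⟨_, hx⟩ := by
  obtain ⟨σ, hσ⟩ := Coding.exists_map hd heq e
  obtain ⟨τ, hτ⟩ := Coding.exists_map hd heq e.symm
  refine ⟨⟨σ, τ, fun a => ?_, fun a => ?_⟩, hσ⟩ <;> obtain ⟨x, rfl⟩ := c.surj a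
  · obtain ⟨hx, ex⟩ := hσ x
    obtain ⟨_, ex'⟩ := hτ ⟨_, hx⟩
    rw [ex, ex']
    congr
    simp [← Function.comp_assoc]
  · obtain ⟨hx, ex⟩ := hτ x
    obtain ⟨_, ex'⟩ := hσ ⟨_, hx⟩
    rw [ex, ex']
    congr
    simp [← Function.comp_assoc]

theorem CodedDefinable.perm_iff {c : Coding M X} {d : Coding M Y} {R : X → Y → Prop}
    (h : CodedDefinable r c d R) {e : r ≃r r} {σ : X → X} {τ : Y → Y}
    (hσ : ∀ x : c.dom, ∃ hx : e ∘ x.1 ∈ c.dom, σ (c.decode x) = c.decode ⟨_, hx⟩)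
    (hτ : ∀ y : d.dom, ∃ hy : e ∘ y.1 ∈ d.dom, τ (d.decode y) = d.decode ⟨_, hy⟩)
    (a : X) (b : Y) : R (σ a) (τ b) ↔ R a b := by
  obtain ⟨x, rfl⟩ := c.surj a
  obtain ⟨y, rfl⟩ := d.surj b
  obtain ⟨hx, ex⟩ := hσ x
  obtain ⟨hy, ey⟩ := hτ y
  rw [ex, ey]
  exact h.map_iff e x y hx hy

variable {F V : Type*} [Field F] [AddCommGroup V] [Module F V]

theorem DefinesGeometry.exists_induces {ξ : LinearMap.BilinForm F V} {k : ℕ}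
    {r : Tang ξ k → Tang ξ k → Prop} (h : DefinesGeometry ξ k r) (f : r ≃r r) :
    ∃ φ : GeomAut ξ, φ.Induces f := by
  obtain ⟨P, L, hP, hL, hPP, hLL, hI, opp, opl, oll, hC⟩ := h
  obtain ⟨σ, hσ⟩ := Coding.exists_perm hP hPP f
  obtain ⟨τ, hτ⟩ := Coding.exists_perm hL hLL f
  exact ⟨⟨σ, τ, hI.perm_iff hσ hτ, opp.perm_iff hσ hσ, opl.perm_iff hσ hτ, oll.perm_iff hτ hτ⟩,
    fun U p => hC.perm_iff (τ := f) hσ (fun _ => ⟨trivial, rfl⟩) p U⟩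

end Isomorphisms

/-! ### Radicals and regular subspaces -/

section Radicals

variable {F V : Type*} [Field F] [AddCommGroup V] [Module F V] {ξ : LinearMap.BilinForm F V}

theorem mem_sup_span_singleton {K : Submodule F V} {w x : V} :
    x ∈ K ⊔ F ∙ w ↔ ∃ y ∈ K, ∃ t : F, y + t • w = x := by
  simp [Submodule.mem_sup, Submodule.mem_span_singleton]

theorem exists_eq_span_singleton {S : Submodule F V} (h : finrank F S = 1) :
    ∃ v ≠ 0, S = F ∙ v := by
  obtain ⟨⟨v, hv⟩, hv₀, hspan⟩ := finrank_eq_one_iff'.1 h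
  refine ⟨v, fun h₀ => hv₀ (Subtype.ext h₀), le_antisymm (fun x hx => ?_)
    ((Submodule.span_singleton_le_iff_mem _ _).2 hv)⟩
  obtain ⟨c, hc⟩ := hspan ⟨x, hx⟩
  exact Submodule.mem_span_singleton.2 ⟨c, congrArg Subtype.val hc⟩

theorem perp_comm (hξ : ξ.IsRefl) {S T : Submodule F V} : Perp ξ S T ↔ Perp ξ T S :=
  ⟨fun h u hu w hw => hξ _ _ (h w hw u hu), fun h u hu w hw => hξ _ _ (h w hw u hu)⟩

theorem perp_span_singleton {p : V} {W : Submodule F V} :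
    Perp ξ (F ∙ p) W ↔ ∀ w ∈ W, ξ p w = 0 := by
  refine ⟨fun h => h p (Submodule.mem_span_singleton_self p), fun h u hu w hw => ?_⟩
  obtain ⟨a, rfl⟩ := Submodule.mem_span_singleton.1 hu
  simp [h w hw]

theorem perp_span_singleton_span_singleton {p q : V} :
    Perp ξ (F ∙ p) (F ∙ q) ↔ ξ p q = 0 := by
  refine perp_span_singleton.trans
    ⟨fun h => h q (Submodule.mem_span_singleton_self q), fun h w hw => ?_⟩
  obtain ⟨a, rfl⟩ := Submodule.mem_span_singleton.1 hw
  simp [h]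

theorem isRegular_iff {H : Submodule F V} :
    IsRegular ξ H ↔ ∀ x ∈ H, (∀ y ∈ H, ξ y x = 0) → x = 0 := by
  rw [IsRegular, Submodule.eq_bot_iff]
  exact ⟨fun h x h₁ h₂ => h x ⟨h₁, h₂⟩, fun h x hx => h x hx.1 hx.2⟩

theorem IsRegular.notMem {H : Submodule F V} (hH : IsRegular ξ H) {w : V} (hw₀ : w ≠ 0)
    (hw : ∀ y ∈ H, ξ y w = 0) : w ∉ H :=
  fun hm => hw₀ (isRegular_iff.1 hH w hm hw)

/-- The radical of `U` is the projective point spanned by `p`. -/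
def HasRad (ξ : LinearMap.BilinForm F V) (U : Submodule F V) (p : V) : Prop :=
  p ≠ 0 ∧ rad ξ U = F ∙ p

namespace HasRad

variable {U : Submodule F V} {p : V}

theorem mem_rad (h : HasRad ξ U p) : p ∈ rad ξ U := h.2 ▸ Submodule.mem_span_singleton_self p

theorem mem (h : HasRad ξ U p) : p ∈ U := h.mem_rad.1

theorem right (h : HasRad ξ U p) {u : V} (hu : u ∈ U) : ξ u p = 0 := h.mem_rad.2 u hu

theorem left (hξ : ξ.IsRefl) (h : HasRad ξ U p) {u : V} (hu : u ∈ U) : ξ p u = 0 :=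
  hξ _ _ (h.right hu)

theorem exists_smul_eq (h : HasRad ξ U p) {x : V} (hx : x ∈ U) (hx' : ∀ u ∈ U, ξ u x = 0) :
    ∃ t : F, t • p = x :=
  Submodule.mem_span_singleton.1 (h.2 ▸ ⟨hx, hx'⟩ : x ∈ F ∙ p)

theorem smul (h : HasRad ξ U p) {t : F} (ht : t ≠ 0) : HasRad ξ U (t • p) :=
  ⟨smul_ne_zero ht h.1,
    h.2.trans (Submodule.span_singleton_smul_eq (IsUnit.mk0 t ht) p).symm⟩

theorem congr (h : HasRad ξ U p) {W : Submodule F V} (e : rad ξ W = rad ξ U) : HasRad ξ W p :=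
  ⟨h.1, e.trans h.2⟩

theorem isTangential (h : HasRad ξ U p) : IsTangential ξ U := by
  rw [IsTangential, h.2, finrank_span_singleton h.1]

theorem isRegular_of_sup_eq (hξ : ξ.IsRefl) (h : HasRad ξ U p) {K : Submodule F V}
    (hp : p ∉ K) (hK : K ⊔ F ∙ p = U) : IsRegular ξ K := by
  refine isRegular_iff.2 fun x hx hx' => ?_
  have hKU : K ≤ U := hK ▸ le_sup_left
  obtain ⟨t, rfl⟩ := h.exists_smul_eq (hKU hx) fun u hu => by
    obtain ⟨y, hy, s, rfl⟩ := mem_sup_span_singleton.1 (hK ▸ hu)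
    simp [hx' y hy, h.left hξ (hKU hx)]
  by_contra ht
  exact hp ((K.smul_mem_iff fun h₀ => ht (smul_eq_zero_of_left h₀ p)).1 hx)

theorem exists_isRegular (hξ : ξ.IsRefl) (h : HasRad ξ U p) :
    ∃ K, IsRegular ξ K ∧ p ∉ K ∧ K ⊔ F ∙ p = U := by
  obtain ⟨K, hd, e⟩ := IsModularLattice.exists_disjoint_and_sup_eq
    ((Submodule.span_singleton_le_iff_mem p U).2 h.mem)
  have hp : p ∉ K := fun hm =>
    h.1 (Submodule.disjoint_def.1 hd p (Submodule.mem_span_singleton_self p) hm)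
  rw [sup_comm] at e
  exact ⟨K, h.isRegular_of_sup_eq hξ hp e, hp, e⟩

end HasRad

theorem IsTangential.exists_hasRad {U : Submodule F V} (h : IsTangential ξ U) :
    ∃ p, HasRad ξ U p :=
  exists_eq_span_singleton h

theorem IsTangential.hasRad {U : Submodule F V} (hU : IsTangential ξ U) {x : V} (hx₀ : x ≠ 0)
    (hx : x ∈ U) (hx' : ∀ u ∈ U, ξ u x = 0) : HasRad ξ U x := by
  obtain ⟨p, hp⟩ := hU.exists_hasRad
  obtain ⟨t, rfl⟩ := hp.exists_smul_eq hx hx'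
  exact hp.smul fun ht => hx₀ (ht ▸ zero_smul F p)

theorem IsRegular.hasRad_sup (hξ : ξ.IsAlt) {H : Submodule F V} (hH : IsRegular ξ H) {w : V}
    (hw₀ : w ≠ 0) (hw : ∀ y ∈ H, ξ y w = 0) : HasRad ξ (H ⊔ F ∙ w) w := by
  refine ⟨hw₀, le_antisymm (fun x hx => ?_) ((Submodule.span_singleton_le_iff_mem _ _).2
    ⟨Submodule.mem_sup_right (Submodule.mem_span_singleton_self w), fun u hu => ?_⟩)⟩
  · obtain ⟨y, hy, t, rfl⟩ := mem_sup_span_singleton.1 hx.1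
    have hy₀ : y = 0 := isRegular_iff.1 hH y hy fun z hz => by
      simpa [hw z hz] using hx.2 z (Submodule.mem_sup_left hz)
    exact Submodule.mem_span_singleton.2 ⟨t, by simp [hy₀]⟩
  · obtain ⟨y, hy, t, rfl⟩ := mem_sup_span_singleton.1 hu
    simp [hw y hy, hξ.self_eq_zero]

theorem rad_map {U : Submodule F V} {φ : V →ₗ[F] V}
    (hφ : ∀ x ∈ U, ∀ y ∈ U, ξ (φ x) (φ y) = ξ x y) : rad ξ (U.map φ) = (rad ξ U).map φ := by
  ext x
  constructor
  · rintro ⟨⟨x, hx, rfl⟩, h⟩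
    exact ⟨x, ⟨hx, fun y hy => (hφ y hy x hx).symm.trans (h _ ⟨y, hy, rfl⟩)⟩, rfl⟩
  · rintro ⟨x, ⟨hx, h⟩, rfl⟩
    refine ⟨⟨x, hx, rfl⟩, ?_⟩
    rintro _ ⟨y, hy, rfl⟩
    exact (hφ y hy x hx).trans (h y hy)

theorem IsRegular.map {H : Submodule F V} (hH : IsRegular ξ H) {φ : V →ₗ[F] V}
    (hφ : ∀ x ∈ H, ∀ y ∈ H, ξ (φ x) (φ y) = ξ x y) : IsRegular ξ (H.map φ) := by
  rw [IsRegular, rad_map hφ, hH, Submodule.map_bot]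

theorem HasRad.map {U : Submodule F V} {p : V} (h : HasRad ξ U p) {φ : V →ₗ[F] V}
    (hφ : ∀ x ∈ U, ∀ y ∈ U, ξ (φ x) (φ y) = ξ x y) (hp : φ p ≠ 0) :
    HasRad ξ (U.map φ) (φ p) :=
  ⟨hp, by rw [rad_map hφ, h.2, Submodule.map_span, Set.image_singleton]⟩

theorem IsRegular.finrank_map {H : Submodule F V} (hH : IsRegular ξ H) {φ : V →ₗ[F] V}
    (hφ : ∀ x ∈ H, ∀ y ∈ H, ξ (φ x) (φ y) = ξ x y) : finrank F (H.map φ) = finrank F H := by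
  have hinj : Function.Injective (φ.domRestrict H) :=
    (injective_iff_map_eq_zero _).2 fun x hx => Subtype.ext <|
      isRegular_iff.1 hH x x.2 fun y hy => by
        rw [← hφ y hy x x.2, ← LinearMap.domRestrict_apply, hx, map_zero]
  rw [← LinearMap.finrank_range_of_inj hinj, LinearMap.range_domRestrict]

variable [FiniteDimensional F V]

theorem eq_iff_le_of_finrank_eq {S T : Submodule F V} (h : finrank F S = finrank F T) :
    S = T ↔ S ≤ T :=
  ⟨le_of_eq, fun hle => Submodule.eq_of_le_of_finrank_eq hle h⟩

theorem sup_span_singleton_eq {K U : Submodule F V} {p : V} (hKU : K ≤ U) (hp : p ∈ U)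
    (hpK : p ∉ K) (hd : finrank F K + 1 = finrank F U) : K ⊔ F ∙ p = U := by
  refine Submodule.eq_of_le_of_finrank_eq
    (sup_le hKU ((Submodule.span_singleton_le_iff_mem _ _).2 hp)) ?_
  rw [Submodule.finrank_sup_span_singleton hpK, hd]

theorem HasRad.isRegular_of_notMem (hξ : ξ.IsRefl) {U K : Submodule F V} {p : V}
    (h : HasRad ξ U p) (hKU : K ≤ U) (hpK : p ∉ K) (hd : finrank F K + 1 = finrank F U) :
    IsRegular ξ K :=
  h.isRegular_of_sup_eq hξ hpK (sup_span_singleton_eq hKU h.mem hpK hd)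

theorem IsRegular.exists_add (hξ : ξ.IsRefl) {H : Submodule F V} (hH : IsRegular ξ H) (v : V) :
    ∃ x ∈ H, ∃ w, (∀ y ∈ H, ξ y w = 0) ∧ x + w = v := by
  have hc : IsCompl H (ξ.orthogonal H) :=
    (LinearMap.BilinForm.isCompl_orthogonal_iff_disjoint hξ).2 (disjoint_iff.2 hH)
  exact Submodule.mem_sup.1 (hc.sup_eq_top ▸ Submodule.mem_top)

theorem IsRegular.exists_tang (hξ : ξ.IsAlt) {H : Submodule F V} (hH : IsRegular ξ H) {k : ℕ}
    (hd : finrank F H + 1 = k) {w : V} (hw₀ : w ≠ 0) (hw : ∀ y ∈ H, ξ y w = 0) :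
    ∃ U : Tang ξ k, U.1 = H ⊔ F ∙ w ∧ HasRad ξ U.1 w :=
  have hrad := hH.hasRad_sup hξ hw₀ hw
  ⟨⟨H ⊔ F ∙ w, (Submodule.finrank_sup_span_singleton (hH.notMem hw₀ hw)).trans hd,
    hrad.isTangential⟩, rfl, hrad⟩

theorem finrank_inf_ker_add_one {U : Submodule F V} {f : Dual F V} {u : V} (hu : u ∈ U)
    (hfu : f u ≠ 0) : finrank F (U ⊓ LinearMap.ker f : Submodule F V) + 1 = finrank F U := by
  have hlt : U ⊓ LinearMap.ker f < U :=
    lt_of_le_of_ne inf_le_left fun e => hfu (inf_eq_left.1 e hu)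
  have := Submodule.finrank_lt_finrank_of_lt hlt
  have := Submodule.finrank_sup_add_finrank_inf_eq U (LinearMap.ker f)
  have := Submodule.finrank_le (U ⊔ LinearMap.ker f)
  have := Dual.finrank_ker_add_one_of_ne_zero (f := f) fun h => hfu (by simp [h])
  omega

theorem finrank_inf_add_one {B U W : Submodule F V} {k : ℕ} (hU : finrank F U = k)
    (hW : finrank F W = k) (hB : finrank F B = k + 1) (hUB : U ≤ B) (hWB : W ≤ B)
    (hne : U ≠ W) : finrank F (U ⊓ W : Submodule F V) + 1 = k := by
  have hsum := Submodule.finrank_sup_add_finrank_inf_eq U W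
  have hsup := Submodule.finrank_mono (sup_le hUB hWB)
  have hlt : U < U ⊔ W := lt_of_le_of_ne le_sup_left fun e =>
    hne (Submodule.eq_of_le_of_finrank_eq (e ▸ le_sup_right : W ≤ U) (hW.trans hU.symm)).symm
  have := Submodule.finrank_lt_finrank_of_lt hlt
  omega

end Radicals

/-! ### Adjacency -/

section Adjacency

variable {F V : Type*} [Field F] [AddCommGroup V] [Module F V]
variable {ξ : LinearMap.BilinForm F V} {k : ℕ} {U W : Tang ξ k} {p q : V}

theorem BotAdj.symm (h : BotAdj ξ k U W) : BotAdj ξ k W U := by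
  rwa [BotAdj, inf_comm]

theorem BotAdj.notMem (h : BotAdj ξ k U W) (hp : HasRad ξ U.1 p) : p ∉ W.1 := fun hm =>
  hp.1 (isRegular_iff.1 h.2 p ⟨hp.mem, hm⟩ fun _ hy => hp.right hy.1)

theorem BotAdj.ne (h : BotAdj ξ k U W) : U ≠ W := by
  rintro rfl
  obtain ⟨p, hp⟩ := U.2.2.exists_hasRad
  exact h.notMem hp hp.mem

theorem BotAdj.coord_eq_zero (h : BotAdj ξ k U W) (hp : HasRad ξ U.1 p) (hq : HasRad ξ W.1 q)
    {x : V} (hx : x ∈ U.1 ⊓ W.1) {a b : F} (e : x + a • p + b • q = 0) :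
    x = 0 ∧ a = 0 ∧ b = 0 := by
  obtain rfl : b = 0 := by
    by_contra hb
    refine h.symm.notMem hq ((U.1.smul_mem_iff hb).1 ?_)
    rw [eq_neg_of_add_eq_zero_right e]
    exact neg_mem (add_mem hx.1 (U.1.smul_mem _ hp.mem))
  rw [zero_smul, add_zero] at e
  obtain rfl : a = 0 := by
    by_contra ha
    refine h.notMem hp ((W.1.smul_mem_iff ha).1 ?_)
    rw [eq_neg_of_add_eq_zero_right e]
    exact neg_mem hx.2
  exact ⟨by simpa using e, rfl, rfl⟩

theorem perp_rad_iff (hp : HasRad ξ U.1 p) {S : Submodule F V} :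
    Perp ξ (rad ξ U.1) S ↔ ∀ w ∈ S, ξ p w = 0 := by
  rw [hp.2, perp_span_singleton]

theorem perp_rad_rad_iff (hp : HasRad ξ U.1 p) (hq : HasRad ξ W.1 q) :
    Perp ξ (rad ξ U.1) (rad ξ W.1) ↔ ξ p q = 0 := by
  rw [hp.2, hq.2, perp_span_singleton_span_singleton]

theorem BotAdj.mem_shear_iff (hξ : ξ.IsAlt) (h : BotAdj ξ k U W) (hp : HasRad ξ U.1 p)
    (hq : HasRad ξ W.1 q) {g x : V} (hg : g ∈ U.1 ⊓ W.1) (hx : x ∈ U.1 ⊓ W.1) {a b c : F} :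
    x + a • p + b • q ∈
      (U.1 ⊓ W.1).map (LinearMap.transvection (ξ g) p) ⊔ F ∙ (p - q - c • g) ↔
      a + b = ξ g x := by
  rw [mem_sup_span_singleton]
  constructor
  · rintro ⟨_, ⟨y, hy, rfl⟩, t, e⟩
    obtain ⟨ex, ea, eb⟩ := h.coord_eq_zero hp hq (a := ξ g y + t - a) (b := - t - b)
      (sub_mem (sub_mem hy (Submodule.smul_mem _ (t * c) hg)) hx)
      (by rw [← sub_eq_zero.2 e, LinearMap.transvection.apply]; module)
    rw [← sub_eq_zero.1 ex, map_sub, map_smul, hξ.self_eq_zero, smul_zero, sub_zero]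
    linear_combination -ea - eb
  · intro e
    refine ⟨_, ⟨x - (b * c) • g, sub_mem hx (Submodule.smul_mem _ _ hg), rfl⟩, -b, ?_⟩
    rw [LinearMap.transvection.apply, map_sub, map_smul, hξ.self_eq_zero, smul_zero, sub_zero,
      ← e]
    module

variable [FiniteDimensional F V]

theorem Tang.eq_of_le (h : U.1 ≤ W.1) : U = W :=
  Subtype.ext (Submodule.eq_of_le_of_finrank_eq h (U.2.1.trans W.2.1.symm))

theorem botAdj_of_notMem (hξ : ξ.IsRefl) (hp : HasRad ξ U.1 p) {B : Submodule F V}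
    (hB : finrank F B = k + 1) (hUB : U.1 ≤ B) (hWB : W.1 ≤ B) (hpW : p ∉ W.1) :
    BotAdj ξ k U W := by
  have hd := finrank_inf_add_one U.2.1 W.2.1 hB hUB hWB fun e => hpW (e ▸ hp.mem)
  exact ⟨hd, hp.isRegular_of_notMem hξ inf_le_left (fun h => hpW h.2) (hd.trans U.2.1.symm)⟩

theorem botAdj_of_isRegular {H : Submodule F V} (hH : IsRegular ξ H) (hd : finrank F H + 1 = k)
    (hU : H ≤ U.1) (hW : H ≤ W.1) (hne : U ≠ W) : BotAdj ξ k U W := by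
  have hlt : U.1 ⊓ W.1 < U.1 :=
    lt_of_le_of_ne inf_le_left fun e => hne (Tang.eq_of_le (inf_eq_left.1 e))
  have e : H = U.1 ⊓ W.1 := Submodule.eq_of_le_of_finrank_le (le_inf hU hW) (by
    have := Submodule.finrank_lt_finrank_of_lt hlt
    have := U.2.1
    omega)
  exact ⟨e ▸ hd, e ▸ hH⟩

theorem BotAdj.finrank_sup (h : BotAdj ξ k U W) :
    finrank F (U.1 ⊔ W.1 : Submodule F V) = k + 1 := by
  have := Submodule.finrank_sup_add_finrank_inf_eq U.1 W.1
  have := h.1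
  have := U.2.1
  have := W.2.1
  omega

theorem BotAdj.inf_sup_eq (h : BotAdj ξ k U W) (hp : HasRad ξ U.1 p) :
    U.1 ⊓ W.1 ⊔ F ∙ p = U.1 :=
  sup_span_singleton_eq inf_le_left hp.mem (fun hm => h.notMem hp hm.2) (h.1.trans U.2.1.symm)

theorem BotAdj.exists_coord (h : BotAdj ξ k U W) (hp : HasRad ξ U.1 p) (hq : HasRad ξ W.1 q)
    {v : V} (hv : v ∈ U.1 ⊔ W.1) : ∃ x ∈ U.1 ⊓ W.1, ∃ a b : F, v = x + a • p + b • q := by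
  obtain ⟨u, hu, w, hw, rfl⟩ := Submodule.mem_sup.1 hv
  rw [← h.inf_sup_eq hp, mem_sup_span_singleton] at hu
  rw [← h.symm.inf_sup_eq hq, mem_sup_span_singleton, inf_comm] at hw
  obtain ⟨x, hx, a, rfl⟩ := hu
  obtain ⟨y, hy, b, rfl⟩ := hw
  exact ⟨x + y, add_mem hx hy, a, b, by abel⟩

end Adjacency

/-! ### Triangles -/

section Triangles

variable {F V : Type*} [Field F] [AddCommGroup V] [Module F V] [FiniteDimensional F V]
variable {ξ : LinearMap.BilinForm F V} {k : ℕ} {U W Z Y Y' : Tang ξ k} {p q : V}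

theorem BotAdj.inf_le_or_le_sup (hUW : BotAdj ξ k U W) (hZU : BotAdj ξ k Z U)
    (hZW : BotAdj ξ k Z W) : U.1 ⊓ W.1 ≤ Z.1 ∨ Z.1 ≤ U.1 ⊔ W.1 := by
  have hUW₁ := hUW.1
  have hZU₁ := hZU.1
  have hZW₁ := hZW.1
  have := Z.2.1
  by_cases e : Z.1 ⊓ U.1 = Z.1 ⊓ W.1
  · have hle : Z.1 ⊓ U.1 ≤ U.1 ⊓ W.1 := le_inf inf_le_right (e ▸ inf_le_right)
    exact .inl (Submodule.eq_of_le_of_finrank_le hle (by omega) ▸ inf_le_left)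
  · have hlt : Z.1 ⊓ U.1 < Z.1 ⊓ U.1 ⊔ Z.1 ⊓ W.1 := lt_of_le_of_ne le_sup_left fun e' =>
      e (Submodule.eq_of_le_of_finrank_le (e' ▸ le_sup_right : Z.1 ⊓ W.1 ≤ Z.1 ⊓ U.1)
        (by omega)).symm
    have := Submodule.finrank_lt_finrank_of_lt hlt
    have hsup : Z.1 ⊓ U.1 ⊔ Z.1 ⊓ W.1 = Z.1 :=
      Submodule.eq_of_le_of_finrank_le (sup_le inf_le_left inf_le_left) (by omega)
    exact .inr (hsup.symm.le.trans (sup_le_sup inf_le_right inf_le_right))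

theorem BotAdj.inf_le_of_not_le_sup (hUW : BotAdj ξ k U W) (hZU : BotAdj ξ k Z U)
    (hZW : BotAdj ξ k Z W) (hZ : ¬ Z.1 ≤ U.1 ⊔ W.1) (hYU : BotAdj ξ k Y U)
    (hYW : BotAdj ξ k Y W) (hYZ : BotAdj ξ k Y Z) : U.1 ⊓ W.1 ≤ Y.1 := by
  have hUWd := hUW.finrank_sup
  have hUZd := hZU.symm.finrank_sup
  have := U.2.1
  have hUW₁ := hUW.1
  have hUZ₁ := hZU.symm.1
  have hHZ : U.1 ⊓ W.1 ≤ Z.1 := (hUW.inf_le_or_le_sup hZU hZW).resolve_right hZ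
  have eH : U.1 ⊓ W.1 = U.1 ⊓ Z.1 :=
    Submodule.eq_of_le_of_finrank_eq (le_inf inf_le_left hHZ) (by omega)
  have hlt : (U.1 ⊔ W.1) ⊓ (U.1 ⊔ Z.1) < U.1 ⊔ W.1 := lt_of_le_of_ne inf_le_left fun e => by
    have e' : U.1 ⊔ W.1 = U.1 ⊔ Z.1 :=
      Submodule.eq_of_le_of_finrank_eq (inf_eq_left.1 e) (by omega)
    exact hZ (e' ▸ le_sup_right)
  have := Submodule.finrank_lt_finrank_of_lt hlt
  have eU : U.1 = (U.1 ⊔ W.1) ⊓ (U.1 ⊔ Z.1) :=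
    Submodule.eq_of_le_of_finrank_le (le_inf le_sup_left le_sup_left) (by omega)
  by_contra hY
  have hYUW := (hUW.inf_le_or_le_sup hYU hYW).resolve_left hY
  have hYUZ := (hZU.symm.inf_le_or_le_sup hYU hYZ).resolve_left (eH ▸ hY)
  exact hYU.ne (Tang.eq_of_le (eU ▸ le_inf hYUW hYUZ))

/-- A triangle of the adjacency graph that lies in the `(k + 1)`-subspace spanned by two of its
vertices; the other triangles share the hyperplane `U ⊓ W`. -/
structure SpanTriangle (ξ : LinearMap.BilinForm F V) (k : ℕ) (U W Z : Tang ξ k) : Prop where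
  adj : BotAdj ξ k U W
  adj_left : BotAdj ξ k Z U
  adj_right : BotAdj ξ k Z W
  le_sup : Z.1 ≤ U.1 ⊔ W.1

theorem BotAdj.spanTriangle (hξ : ξ.IsRefl) (h : BotAdj ξ k U W) (hp : HasRad ξ U.1 p)
    (hq : HasRad ξ W.1 q) (hZ : Z.1 ≤ U.1 ⊔ W.1) (hpZ : p ∉ Z.1) (hqZ : q ∉ Z.1) :
    SpanTriangle ξ k U W Z :=
  ⟨h, (botAdj_of_notMem hξ hp h.finrank_sup le_sup_left hZ hpZ).symm,
    (botAdj_of_notMem hξ hq h.finrank_sup le_sup_right hZ hqZ).symm, hZ⟩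

/-- With coordinates `x + a • p + b • q`, `x ∈ U ⊓ W`, on `U ⊔ W`, the hyperplane `a + b = ξ g x`
is spanned by the image of `U ⊓ W` under the transvection `x ↦ x + ξ g x • p`, an isometry on
`U ⊓ W`, and by a vector orthogonal to that image. -/
theorem BotAdj.exists_shear (hξ : ξ.IsAlt) (h : BotAdj ξ k U W) (hp : HasRad ξ U.1 p)
    (hq : HasRad ξ W.1 q) {g : V} (hg : g ∈ U.1 ⊓ W.1) :
    ∃ Y : Tang ξ k, SpanTriangle ξ k U W Y ∧ HasRad ξ Y.1 (p - q - ξ p q • g) ∧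
      ∀ x ∈ U.1 ⊓ W.1, ∀ a b : F, x + a • p + b • q ∈ Y.1 ↔ a + b = ξ g x := by
  set H := U.1 ⊓ W.1
  set w := p - q - ξ p q • g with hw
  set φ := LinearMap.transvection (ξ g) p
  have hφ (x : V) : φ x = x + ξ g x • p := rfl
  have hφH : ∀ x ∈ H, ∀ y ∈ H, ξ (φ x) (φ y) = ξ x y := fun x hx y hy => by
    simp [hφ, hp.right hx.1, hp.left hξ.isRefl hy.1, hξ.self_eq_zero]
  have hwφ : ∀ y ∈ H.map φ, ξ y w = 0 := by
    rintro _ ⟨x, hx, rfl⟩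
    simp only [hw, hφ, map_add, map_sub, map_smul, LinearMap.add_apply, LinearMap.smul_apply,
      smul_eq_mul, hp.right hx.1, hq.right hx.2, hp.left hξ.isRefl hg.1, hξ.self_eq_zero,
      ← LinearMap.IsAlt.neg hξ g x]
    ring
  have hw₀ : w ≠ 0 := fun e => one_ne_zero (h.coord_eq_zero hp hq
    (neg_mem (H.smul_mem (ξ p q) hg)) (a := 1) (b := -1) (by rw [← e]; module)).2.1
  have hd : finrank F (H.map φ) + 1 = k := (h.2.finrank_map hφH).symm ▸ h.1
  obtain ⟨Y, hY, hYw⟩ := (h.2.map hφH).exists_tang hξ hd hw₀ hwφ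
  have hmem : ∀ x ∈ H, ∀ a b : F, x + a • p + b • q ∈ Y.1 ↔ a + b = ξ g x :=
    fun x hx a b => hY ▸ h.mem_shear_iff hξ hp hq hg hx
  refine ⟨Y, h.spanTriangle hξ.isRefl hp hq ?_ (fun hm => ?_) fun hm => ?_, hYw, hmem⟩
  · rw [hY]
    refine sup_le ?_ ((Submodule.span_singleton_le_iff_mem _ _).2 (sub_mem (sub_mem
      (Submodule.mem_sup_left hp.mem) (Submodule.mem_sup_right hq.mem))
      (Submodule.mem_sup_left (U.1.smul_mem _ hg.1))))
    rintro _ ⟨x, hx, rfl⟩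
    exact Submodule.mem_sup_left (add_mem hx.1 (U.1.smul_mem _ hp.mem))
  · simpa using (hmem 0 (zero_mem _) 1 0).1 (by simpa using hm)
  · simpa using (hmem 0 (zero_mem _) 0 1).1 (by simpa using hm)

theorem SpanTriangle.exists_hasRad_add (h : SpanTriangle ξ k U W Z) :
    ∃ p q, HasRad ξ U.1 p ∧ HasRad ξ W.1 q ∧
      ∃ x ∈ U.1 ⊓ W.1, HasRad ξ Z.1 (x + p + q) := by
  obtain ⟨p, hp⟩ := U.2.2.exists_hasRad
  obtain ⟨q, hq⟩ := W.2.2.exists_hasRad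
  obtain ⟨z, hz⟩ := Z.2.2.exists_hasRad
  obtain ⟨x, hx, a, b, rfl⟩ := h.adj.exists_coord hp hq (h.le_sup hz.mem)
  have ha : a ≠ 0 := fun ha => h.adj_right.notMem hz <| by
    simpa [ha] using add_mem hx.2 (W.1.smul_mem b hq.mem)
  have hb : b ≠ 0 := fun hb => h.adj_left.notMem hz <| by
    simpa [hb] using add_mem hx.1 (U.1.smul_mem a hp.mem)
  exact ⟨a • p, b • q, hp.smul ha, hq.smul hb, x, hx, hz⟩

theorem SpanTriangle.exists_not_botAdj (hξ : ξ.IsAlt) (h2 : (2 : F) ≠ 0) (hk : 2 ≤ k)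
    (h : SpanTriangle ξ k U W Z) :
    ∃ Y Y' : Tang ξ k, (BotAdj ξ k Y U ∧ BotAdj ξ k Y W ∧ BotAdj ξ k Y Z) ∧
      (BotAdj ξ k Y' U ∧ BotAdj ξ k Y' W ∧ BotAdj ξ k Y' Z) ∧ Y ≠ Y' ∧ ¬ BotAdj ξ k Y Y' := by
  obtain ⟨p, q, hp, hq, x, hx, hz⟩ := h.exists_hasRad_add
  obtain ⟨g, hg, hg₀, hgx⟩ : ∃ g ∈ U.1 ⊓ W.1, g ≠ 0 ∧ ξ g x = 0 := by
    by_cases hx₀ : x = 0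
    · have hne : U.1 ⊓ W.1 ≠ ⊥ := fun e => by
        have := h.adj.1
        rw [e, finrank_bot] at this
        omega
      obtain ⟨g, hg, hg₀⟩ := Submodule.exists_mem_ne_zero_of_ne_bot hne
      exact ⟨g, hg, hg₀, by simp [hx₀]⟩
    · exact ⟨x, hx, hx₀, hξ.self_eq_zero x⟩
  obtain ⟨Y, hY, hYrad, hYmem⟩ := h.adj.exists_shear hξ hp hq (zero_mem _)
  obtain ⟨Y', hY', -, hY'mem⟩ := h.adj.exists_shear hξ hp hq hg
  have adj_Z {T : Tang ξ k} (hT : SpanTriangle ξ k U W T) (hz' : x + p + q ∉ T.1) :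
      BotAdj ξ k T Z :=
    (botAdj_of_notMem hξ.isRefl hz h.adj.finrank_sup h.le_sup hT.le_sup hz').symm
  have hzY : x + p + q ∉ Y.1 := fun hm => h2 <| by
    simpa [one_add_one_eq_two] using (hYmem x hx 1 1).1 (by simpa using hm)
  have hzY' : x + p + q ∉ Y'.1 := fun hm => h2 <| by
    simpa [one_add_one_eq_two, hgx] using (hY'mem x hx 1 1).1 (by simpa using hm)
  refine ⟨Y, Y', ⟨hY.adj_left, hY.adj_right, adj_Z hY hzY⟩,
    ⟨hY'.adj_left, hY'.adj_right, adj_Z hY' hzY'⟩, fun e => hg₀ ?_, fun hadj => ?_⟩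
  · refine isRegular_iff.1 h.adj.2 g hg fun y hy => hξ.isRefl _ _ ?_
    have hyY : y + (0 : F) • p + (0 : F) • q ∈ Y.1 := (hYmem y hy 0 0).2 (by simp)
    simpa using ((hY'mem y hy 0 0).1 (e ▸ hyY)).symm
  · refine hadj.notMem hYrad ?_
    simpa [sub_eq_add_neg] using (hY'mem 0 (zero_mem _) 1 (-1)).2 (by simp)

theorem spanTriangle_iff (hξ : ξ.IsAlt) (h2 : (2 : F) ≠ 0) (hk : 2 ≤ k) :
    SpanTriangle ξ k U W Z ↔ (BotAdj ξ k U W ∧ BotAdj ξ k Z U ∧ BotAdj ξ k Z W) ∧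
      ∃ Y Y' : Tang ξ k, (BotAdj ξ k Y U ∧ BotAdj ξ k Y W ∧ BotAdj ξ k Y Z) ∧
        (BotAdj ξ k Y' U ∧ BotAdj ξ k Y' W ∧ BotAdj ξ k Y' Z) ∧ Y ≠ Y' ∧
        ¬ BotAdj ξ k Y Y' := by
  refine ⟨fun h => ⟨⟨h.adj, h.adj_left, h.adj_right⟩, h.exists_not_botAdj hξ h2 hk⟩, ?_⟩
  rintro ⟨⟨hUW, hZU, hZW⟩, Y, Y', ⟨hYU, hYW, hYZ⟩, ⟨hYU', hYW', hYZ'⟩, hne, hn⟩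
  refine ⟨hUW, hZU, hZW, not_not.1 fun hZ => hn ?_⟩
  exact botAdj_of_isRegular hUW.2 hUW.1 (hUW.inf_le_of_not_le_sup hZU hZW hZ hYU hYW hYZ)
    (hUW.inf_le_of_not_le_sup hZU hZW hZ hYU' hYW' hYZ') hne

end Triangles

/-! ### Radicals of adjacent subspaces -/

section OrthAdj

variable {F V : Type*} [Field F] [AddCommGroup V] [Module F V] [FiniteDimensional F V]
variable {ξ : LinearMap.BilinForm F V} {k : ℕ} {U W X Y : Tang ξ k} {p : V}

/-- Adjacency with orthogonal radicals; equivalently, adjacency with a sum that is not regular. -/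
def OrthAdj (ξ : LinearMap.BilinForm F V) (k : ℕ) (U W : Tang ξ k) : Prop :=
  BotAdj ξ k U W ∧ Perp ξ (rad ξ U.1) (rad ξ W.1)

theorem OrthAdj.perp_sup (hξ : ξ.IsAlt) (h : OrthAdj ξ k U W) (hp : HasRad ξ U.1 p) :
    ∀ v ∈ U.1 ⊔ W.1, ξ v p = 0 := by
  intro v hv
  obtain ⟨q, hq⟩ := W.2.2.exists_hasRad
  obtain ⟨x, hx, a, b, rfl⟩ := h.1.exists_coord hp hq hv
  simp [hp.right hx.1, hξ.self_eq_zero, hξ.isRefl _ _ ((perp_rad_rad_iff hp hq).1 h.2)]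

theorem SpanTriangle.rad_eq_of_not_botAdj (hξ : ξ.IsAlt) (h : OrthAdj ξ k U W)
    (hX : SpanTriangle ξ k U W X) (hY : SpanTriangle ξ k U W Y) (hXY : ¬ BotAdj ξ k X Y) :
    rad ξ X.1 = rad ξ Y.1 := by
  obtain ⟨p, hp⟩ := U.2.2.exists_hasRad
  obtain ⟨x, hx⟩ := X.2.2.exists_hasRad
  have hX_sup : X.1 ⊔ F ∙ p = U.1 ⊔ W.1 :=
    sup_span_singleton_eq hX.le_sup (Submodule.mem_sup_left hp.mem) (hX.adj_left.symm.notMem hp)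
      (by rw [h.1.finrank_sup, X.2.1])
  have hx_perp : ∀ v ∈ U.1 ⊔ W.1, ξ v x = 0 := by
    intro v hv
    obtain ⟨y, hy, t, rfl⟩ := mem_sup_span_singleton.1 (hX_sup ▸ hv)
    simp [hx.right hy, hξ.isRefl _ _ (h.perp_sup hξ hp x (hX.le_sup hx.mem))]
  have hxY : x ∈ Y.1 := by
    by_contra hxY
    exact hXY (botAdj_of_notMem hξ.isRefl hx h.1.finrank_sup hX.le_sup hY.le_sup hxY)
  rw [hx.2, (Y.2.2.hasRad hx.1 hxY fun u hu => hx_perp u (hY.le_sup hu)).2]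

theorem BotAdj.exists_not_transitive (hξ : ξ.IsAlt) (hk : 2 ≤ k) (h : BotAdj ξ k U W)
    (hUW : ¬ Perp ξ (rad ξ U.1) (rad ξ W.1)) :
    ∃ X Y Z, SpanTriangle ξ k U W X ∧ SpanTriangle ξ k U W Y ∧ SpanTriangle ξ k U W Z ∧
      ¬ BotAdj ξ k X Y ∧ ¬ BotAdj ξ k Y Z ∧ BotAdj ξ k X Z := by
  obtain ⟨p, hp⟩ := U.2.2.exists_hasRad
  obtain ⟨q, hq⟩ := W.2.2.exists_hasRad
  rw [perp_rad_rad_iff hp hq] at hUW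
  have hne : U.1 ⊓ W.1 ≠ ⊥ := fun e => by
    have := h.1
    rw [e, finrank_bot] at this
    omega
  obtain ⟨g, hg, hg₀⟩ := Submodule.exists_mem_ne_zero_of_ne_bot hne
  obtain ⟨g', hg', hgg⟩ : ∃ g' ∈ U.1 ⊓ W.1, ξ g' g ≠ 0 := by
    by_contra! hcon
    exact hg₀ (isRegular_iff.1 h.2 g hg hcon)
  obtain ⟨X, hX, hXrad, hXmem⟩ := h.exists_shear hξ hp hq hg
  obtain ⟨Y, hY, hYrad, -⟩ := h.exists_shear hξ hp hq (zero_mem _)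
  obtain ⟨Z, hZ, -, hZmem⟩ := h.exists_shear hξ hp hq hg'
  rw [smul_zero, sub_zero] at hYrad
  refine ⟨X, Y, Z, hX, hY, hZ, fun hadj => hadj.symm.notMem hYrad ?_,
    fun hadj => hadj.notMem hYrad ?_,
    botAdj_of_notMem hξ.isRefl hXrad h.finrank_sup hX.le_sup hZ.le_sup fun hm => ?_⟩
  · simpa [sub_eq_add_neg] using (hXmem 0 (zero_mem _) 1 (-1)).2 (by simp)
  · simpa [sub_eq_add_neg] using (hZmem 0 (zero_mem _) 1 (-1)).2 (by simp)
  · rw [show p - q - ξ p q • g = -(ξ p q • g) + (1 : F) • p + (-1 : F) • q by module,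
      hZmem _ (neg_mem (Submodule.smul_mem _ _ hg))] at hm
    simp [hUW, hgg] at hm

theorem orthAdj_iff (hξ : ξ.IsAlt) (hk : 2 ≤ k) :
    OrthAdj ξ k U W ↔ BotAdj ξ k U W ∧ ∀ X Y Z, SpanTriangle ξ k U W X →
      SpanTriangle ξ k U W Y → SpanTriangle ξ k U W Z →
      ¬ BotAdj ξ k X Y → ¬ BotAdj ξ k Y Z → ¬ BotAdj ξ k X Z := by
  refine ⟨fun h => ⟨h.1, fun X Y Z hX hY hZ hXY hYZ hXZ => ?_⟩, fun ⟨h, H⟩ => ⟨h, ?_⟩⟩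
  · have e := (hX.rad_eq_of_not_botAdj hξ h hY hXY).trans (hY.rad_eq_of_not_botAdj hξ h hZ hYZ)
    obtain ⟨x, hx⟩ := X.2.2.exists_hasRad
    exact hXZ.notMem hx (hx.congr e.symm).mem
  · by_contra hUW
    obtain ⟨X, Y, Z, hX, hY, hZ, hXY, hYZ, hXZ⟩ :=
      h.exists_not_transitive hξ hk hUW
    exact H X Y Z hX hY hZ hXY hYZ hXZ

end OrthAdj

section RadAdj

variable {F V : Type*} [Field F] [AddCommGroup V] [Module F V]
variable {ξ : LinearMap.BilinForm F V} {k : ℕ} {Y Y' : Tang ξ k} {r w : V}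

/-- Equal radicals and an intersection of codimension at most one: the steps of the chains that
connect tangential subspaces with the same radical. -/
def RadAdj (ξ : LinearMap.BilinForm F V) (k : ℕ) (U W : Tang ξ k) : Prop :=
  rad ξ U.1 = rad ξ W.1 ∧ k ≤ finrank F (U.1 ⊓ W.1 : Submodule F V) + 1

theorem RadAdj.refl (Y : Tang ξ k) : RadAdj ξ k Y Y :=
  ⟨rfl, by rw [inf_idem, Y.2.1]; omega⟩

variable [FiniteDimensional F V]

theorem HasRad.exists_orthAdj_of_perp (hξ : ξ.IsAlt) (hr : HasRad ξ Y.1 r) (hwY : w ∉ Y.1)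
    (hw : ∀ y ∈ Y.1, ξ y w = 0) :
    ∃ U W : Tang ξ k, OrthAdj ξ k U W ∧ HasRad ξ U.1 w ∧ HasRad ξ W.1 (w + r) ∧
      Y.1 ⊔ F ∙ w ≤ U.1 ⊔ W.1 := by
  obtain ⟨H, hH, hrH, hHY_sup⟩ := hr.exists_isRegular hξ.isRefl
  have hHY : H ≤ Y.1 := hHY_sup ▸ le_sup_left
  have hd : finrank F H + 1 = k := by
    rw [← Submodule.finrank_sup_span_singleton hrH, hHY_sup, Y.2.1]
  have hw₀ : w ≠ 0 := fun e => hwY (e ▸ zero_mem _)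
  have hwr₀ : w + r ≠ 0 := fun e =>
    hwY (eq_neg_of_add_eq_zero_left e ▸ neg_mem hr.mem)
  have hwr : ξ w r = 0 := hξ.isRefl _ _ (hw r hr.mem)
  obtain ⟨U, hU, hUw⟩ := hH.exists_tang hξ hd hw₀ fun y hy => hw y (hHY hy)
  obtain ⟨W, hW, hWw⟩ := hH.exists_tang hξ hd hwr₀ fun y hy => by
    rw [map_add, hw y (hHY hy), hr.right (hHY hy), add_zero]
  have hUW : U ≠ W := by
    rintro rfl
    have hrU : r ∈ U.1 := (Submodule.add_mem_iff_right _ hUw.mem).1 hWw.mem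
    obtain ⟨t, ht⟩ := hUw.exists_smul_eq hrU fun u hu => by
      obtain ⟨y, hy, t, rfl⟩ := mem_sup_span_singleton.1 (hU ▸ hu)
      simp [hr.right (hHY hy), hwr]
    have ht₀ : t ≠ 0 := fun h₀ => hr.1 (by rw [← ht, h₀, zero_smul])
    exact hwY ((Y.1.smul_mem_iff ht₀).1 (ht ▸ hr.mem))
  have hadj := botAdj_of_isRegular hH hd (hU ▸ le_sup_left) (hW ▸ le_sup_left) hUW
  have hwB : w ∈ U.1 ⊔ W.1 := Submodule.mem_sup_left hUw.mem
  refine ⟨U, W, ⟨hadj, ?_⟩, hUw, hWw,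
    sup_le ?_ ((Submodule.span_singleton_le_iff_mem _ _).2 hwB)⟩
  · simp [perp_rad_rad_iff hUw hWw, hwr, hξ.self_eq_zero]
  · rw [← hHY_sup]
    refine sup_le ((hU ▸ le_sup_left : H ≤ U.1).trans le_sup_left)
      ((Submodule.span_singleton_le_iff_mem _ _).2 ?_)
    exact (Submodule.add_mem_iff_right _ hwB).1 (Submodule.mem_sup_right hWw.mem)

theorem HasRad.exists_perp (hξ : ξ.IsRefl) {S : Submodule F V} (hr : HasRad ξ S r) {v : V}
    (hv : ξ v r = 0) : ∃ y ∈ S, ∀ u ∈ S, ξ u (v - y) = 0 := by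
  obtain ⟨H, hH, -, e⟩ := hr.exists_isRegular hξ
  obtain ⟨x, hx, w, hw, rfl⟩ := hH.exists_add hξ v
  have hHS : H ≤ S := e ▸ le_sup_left
  refine ⟨x, hHS hx, fun u hu => ?_⟩
  obtain ⟨y, hy, t, rfl⟩ := mem_sup_span_singleton.1 (e ▸ hu)
  have hwr : ξ r w = 0 := hξ _ _ (by simpa [hr.right (hHS hx)] using hv)
  simp [hw y hy, hwr]

theorem RadAdj.exists_spanTriangle (hξ : ξ.IsAlt) (h : RadAdj ξ k Y Y') (hne : Y ≠ Y') :
    ∃ U W, OrthAdj ξ k U W ∧ SpanTriangle ξ k U W Y ∧ SpanTriangle ξ k U W Y' := by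
  obtain ⟨r, hY⟩ := Y.2.2.exists_hasRad
  have hY' : HasRad ξ Y'.1 r := hY.congr h.1.symm
  have hlt : Y.1 ⊓ Y'.1 < Y'.1 :=
    lt_of_le_of_ne inf_le_right fun e => hne (Tang.eq_of_le (inf_eq_right.1 e)).symm
  obtain ⟨y', hy', hy'Y⟩ := Set.exists_of_ssubset hlt
  obtain ⟨y, hy, hw⟩ := hY.exists_perp hξ.isRefl (hY'.right hy')
  have hwY : y' - y ∉ Y.1 := fun hm => hy'Y ⟨by simpa using add_mem hm hy, hy'⟩
  obtain ⟨U, W, hUW, hU, hW, hsup⟩ := hY.exists_orthAdj_of_perp hξ hwY hw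
  have hYsup : Y.1 ≤ U.1 ⊔ W.1 := le_sup_left.trans hsup
  have hy'sup : y' ∈ U.1 ⊔ W.1 := by
    simpa using add_mem (Submodule.mem_sup_left hU.mem : y' - y ∈ U.1 ⊔ W.1) (hYsup hy)
  have hY'sup : Y'.1 ≤ U.1 ⊔ W.1 := by
    rw [← sup_span_singleton_eq inf_le_right hy' hy'Y (by
      have := Submodule.finrank_lt_finrank_of_lt hlt
      have := h.2
      have := Y'.2.1
      omega)]
    exact sup_le (inf_le_left.trans hYsup) ((Submodule.span_singleton_le_iff_mem _ _).2 hy'sup)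
  have hwY' : y' - y ∉ Y'.1 := fun hm => by
    obtain ⟨t, ht⟩ := hY'.exists_smul_eq hm fun u hu => hUW.perp_sup hξ hU u (hY'sup hu)
    exact hwY (ht ▸ Y.1.smul_mem t hY.mem)
  exact ⟨U, W, hUW,
    hUW.1.spanTriangle hξ.isRefl hU hW hYsup hwY fun hm =>
      hwY ((Submodule.add_mem_iff_left _ hY.mem).1 hm),
    hUW.1.spanTriangle hξ.isRefl hU hW hY'sup hwY' fun hm =>
      hwY' ((Submodule.add_mem_iff_left _ hY'.mem).1 hm)⟩

theorem radAdj_iff (hξ : ξ.IsAlt) :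
    RadAdj ξ k Y Y' ↔ Y = Y' ∨ ∃ U W, OrthAdj ξ k U W ∧ SpanTriangle ξ k U W Y ∧
      SpanTriangle ξ k U W Y' ∧ ¬ BotAdj ξ k Y Y' := by
  constructor
  · refine fun h => or_iff_not_imp_left.2 fun hne => ?_
    obtain ⟨r, hY⟩ := Y.2.2.exists_hasRad
    obtain ⟨U, W, hUW, hU, hW⟩ := h.exists_spanTriangle hξ hne
    exact ⟨U, W, hUW, hU, hW, fun hadj => hadj.notMem hY (hY.congr h.1.symm).mem⟩
  · rintro (rfl | ⟨U, W, h, hY, hY', hn⟩)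
    · exact .refl Y
    · refine ⟨hY.rad_eq_of_not_botAdj hξ h hY' hn, ?_⟩
      have := Submodule.finrank_sup_add_finrank_inf_eq Y.1 Y'.1
      have := Submodule.finrank_mono (sup_le hY.le_sup hY'.le_sup)
      have := h.1.finrank_sup
      have := Y.2.1
      have := Y'.2.1
      omega

end RadAdj

/-! ### Chains of subspaces with the same radical -/

section SameRadical

variable {F V : Type*} [Field F] [AddCommGroup V] [Module F V] [FiniteDimensional F V]
variable {ξ : LinearMap.BilinForm F V} {k : ℕ} {U W : Tang ξ k} {r u v w : V}

/-- The transvection `y ↦ y + ξ y v / ξ u v • v` maps `u` to `u + v` and fixes `r`. -/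
theorem HasRad.exists_radAdj_add_mem (hξ : ξ.IsAlt) (hU : HasRad ξ U.1 r) (hu : u ∈ U.1)
    (hvr : ξ v r = 0) (huv : ξ u v ≠ 0) :
    ∃ X : Tang ξ k, HasRad ξ X.1 r ∧ RadAdj ξ k U X ∧ u + v ∈ X.1 ∧
      ∀ y ∈ U.1, ξ y v = 0 → y ∈ X.1 := by
  have hv : ((ξ u v)⁻¹ • ξ.flip v) v = 0 := by simp [hξ.self_eq_zero]
  set τ := LinearEquiv.transvection hv
  have hτ (y : V) : τ y = y + ((ξ u v)⁻¹ * ξ y v) • v := rfl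
  have hτ_fix (y : V) (hy : ξ y v = 0) : τ y = y := by simp [hτ, hy]
  have hτ_isom (x y : V) : ξ (τ x) (τ y) = ξ x y := by
    simp only [hτ, map_add, map_smul, LinearMap.add_apply, LinearMap.smul_apply, smul_eq_mul,
      hξ.self_eq_zero, ← LinearMap.IsAlt.neg hξ y v]
    ring
  have hτr : τ r = r := hτ_fix r (hξ.isRefl _ _ hvr)
  have hX : HasRad ξ (U.1.map (τ : V →ₗ[F] V)) r := by
    have := hU.map (φ := (τ : V →ₗ[F] V)) (fun x _ y _ => hτ_isom x y) (by simp [hτr, hU.1])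
    rwa [LinearEquiv.coe_coe, hτr] at this
  have hfix (y : V) (hy : y ∈ U.1) (hyv : ξ y v = 0) : y ∈ U.1.map (τ : V →ₗ[F] V) :=
    ⟨y, hy, hτ_fix y hyv⟩
  refine ⟨⟨_, (LinearEquiv.finrank_map_eq τ U.1).trans U.2.1, hX.isTangential⟩, hX,
    ⟨hU.2.trans hX.2.symm, ?_⟩, ⟨u, hu, by simp [hτ, huv]⟩, hfix⟩
  have hle : U.1 ⊓ LinearMap.ker (ξ.flip v) ≤ U.1 ⊓ U.1.map (τ : V →ₗ[F] V) :=
    le_inf inf_le_left fun y hy => hfix y hy.1 hy.2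
  have := Submodule.finrank_mono hle
  have := finrank_inf_ker_add_one hu (f := ξ.flip v) huv
  have := U.2.1
  change k ≤ finrank F (U.1 ⊓ U.1.map (τ : V →ₗ[F] V) : Submodule F V) + 1
  omega

theorem HasRad.exists_sub_perp_inf (hξ : ξ.IsRefl) (hU : HasRad ξ U.1 r)
    (hW : HasRad ξ W.1 r) (hne : U ≠ W) :
    ∃ u ∈ U.1, u ∉ W.1 ∧ ∃ w ∈ W.1, w ∉ U.1 ∧ ∀ y ∈ U.1 ⊓ W.1, ξ y (u - w) = 0 := by
  obtain ⟨u, hu, huW⟩ := SetLike.not_le_iff_exists.1 fun h => hne (Tang.eq_of_le h)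
  obtain ⟨w, hw, hwU⟩ := SetLike.not_le_iff_exists.1 fun h => hne (Tang.eq_of_le h).symm
  obtain ⟨u', hu', hwu'⟩ := hU.exists_perp hξ (hW.right hw)
  obtain ⟨w', hw', huw'⟩ := hW.exists_perp hξ (hU.right hu)
  by_cases hu'W : u' ∈ W.1
  · by_cases hw'U : w' ∈ U.1
    · refine ⟨u - w', sub_mem hu hw'U, fun h => huW (by simpa using add_mem h hw'),
        w - u', sub_mem hw hu'W, fun h => hwU (by simpa using add_mem h hu'), fun y hy => ?_⟩
      rw [map_sub, huw' y hy.2, hwu' y hy.1, sub_zero]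
    · exact ⟨u, hu, huW, w', hw', hw'U, fun y hy => huw' y hy.2⟩
  · exact ⟨u', hu', hu'W, w, hw, hwU, fun y hy => by
      rw [← neg_sub w u', map_neg, hwu' y hy.1, neg_zero]⟩

theorem exists_perp_of_notMem (hξ : ξ.IsRefl) (hnd : ξ.Nondegenerate) {S : Submodule F V}
    (hv : v ∉ S) : ∃ z, (∀ y ∈ S, ξ y z = 0) ∧ ξ v z ≠ 0 := by
  rw [← LinearMap.BilinForm.orthogonal_orthogonal hnd hξ S] at hv
  simp only [LinearMap.BilinForm.mem_orthogonal_iff] at hv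
  push Not at hv
  obtain ⟨z, hz, hzv⟩ := hv
  exact ⟨z, hz, fun h => hzv (hξ _ _ h)⟩

theorem exists_perp_of_notMem_of_notMem (hξ : ξ.IsRefl) (hnd : ξ.Nondegenerate)
    {S : Submodule F V} (hv : v ∉ S) (hw : w ∉ S) :
    ∃ z, (∀ y ∈ S, ξ y z = 0) ∧ ξ v z ≠ 0 ∧ ξ w z ≠ 0 := by
  obtain ⟨z, hz, hvz⟩ := exists_perp_of_notMem hξ hnd hv
  obtain ⟨z', hz', hwz'⟩ := exists_perp_of_notMem hξ hnd hw
  by_cases hwz : ξ w z = 0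
  · by_cases hvz' : ξ v z' = 0
    · exact ⟨z + z', fun y hy => by simp [hz y hy, hz' y hy], by simpa [hvz'], by simpa [hwz]⟩
    · exact ⟨z', hz', hvz', hwz'⟩
  · exact ⟨z, hz, hvz, hwz⟩

theorem HasRad.exists_radAdj_inf_lt (hξ : ξ.IsAlt) {S : Submodule F V} (hU : HasRad ξ U.1 r)
    (hW : HasRad ξ W.1 r) (hSU : S ≤ U.1) (hSW : S ≤ W.1) (hu : u ∈ U.1) (hw : w ∈ W.1)
    (hwS : w ∉ S) (hS : ∀ y ∈ S, ξ y (u - w) = 0) (huw : ξ u w ≠ 0) :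
    ∃ X : Tang ξ k, HasRad ξ X.1 r ∧ RadAdj ξ k U X ∧ S < X.1 ⊓ W.1 := by
  obtain ⟨X, hX, hUX, hwX, hmem⟩ := hU.exists_radAdj_add_mem hξ hu (v := w - u)
    (by simp [hU.right hu, hW.right hw]) (by simpa [hξ.self_eq_zero] using huw)
  rw [add_sub_cancel] at hwX
  have hSX : S ≤ X.1 := fun y hy => hmem y (hSU hy) (by
    rw [← neg_sub u w, map_neg, hS y hy, neg_zero])
  exact ⟨X, hX, hUX, lt_of_le_of_ne (le_inf hSX hSW) fun e => hwS (e ▸ ⟨hwX, hw⟩)⟩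

theorem HasRad.exists_comp_radAdj_inf_lt (hξ : ξ.IsAlt) (hnd : ξ.Nondegenerate)
    (hU : HasRad ξ U.1 r) (hW : HasRad ξ W.1 r) (hne : U ≠ W) :
    ∃ Y : Tang ξ k, HasRad ξ Y.1 r ∧ Relation.Comp (RadAdj ξ k) (RadAdj ξ k) U Y ∧
      U.1 ⊓ W.1 < Y.1 ⊓ W.1 := by
  obtain ⟨u, hu, huW, w, hw, hwU, hS⟩ := hU.exists_sub_perp_inf hξ.isRefl hW hne
  have huS : u ∉ U.1 ⊓ W.1 := fun h => huW h.2
  have hwS : w ∉ U.1 ⊓ W.1 := fun h => hwU h.1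
  by_cases huw : ξ u w = 0
  · obtain ⟨z, hz, huz, hwz⟩ := exists_perp_of_notMem_of_notMem hξ.isRefl hnd huS hwS
    obtain ⟨X, hX, hUX, hxX, hmem⟩ :=
      hU.exists_radAdj_add_mem hξ hu (hξ.isRefl _ _ (hz r ⟨hU.mem, hW.mem⟩)) huz
    obtain ⟨Y, hY, hXY, hlt⟩ := hX.exists_radAdj_inf_lt hξ (S := U.1 ⊓ W.1) hW
      (fun y hy => hmem y hy.1 (hz y hy)) inf_le_right hxX hw hwS
      (fun y hy => by rw [add_sub_right_comm, map_add, hS y hy, hz y hy, add_zero])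
      (by simpa [huw] using fun h => hwz (hξ.isRefl _ _ h))
    exact ⟨Y, hY, ⟨X, hUX, hXY⟩, hlt⟩
  · obtain ⟨X, hX, hUX, hlt⟩ :=
      hU.exists_radAdj_inf_lt hξ hW inf_le_left inf_le_right hu hw hwS hS huw
    exact ⟨X, hX, ⟨X, hUX, .refl X⟩, hlt⟩

theorem iterate_comp_radAdj_of_rad_eq (hξ : ξ.IsAlt) (hnd : ξ.Nondegenerate) {n : ℕ}
    (h : rad ξ U.1 = rad ξ W.1) (hn : k ≤ finrank F (U.1 ⊓ W.1 : Submodule F V) + n) :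
    ((Relation.Comp (Relation.Comp (RadAdj ξ k) (RadAdj ξ k)))^[n] Eq) U W := by
  induction n generalizing U with
  | zero =>
    have e : U.1 ⊓ W.1 = U.1 :=
      Submodule.eq_of_le_of_finrank_le inf_le_left (by rw [U.2.1]; exact hn)
    exact Tang.eq_of_le (inf_eq_left.1 e)
  | succ n ih =>
    rw [Function.iterate_succ_apply']
    rcases eq_or_ne U W with rfl | hne
    · exact ⟨U, ⟨U, .refl U, .refl U⟩, ih rfl (by rw [inf_idem, U.2.1]; omega)⟩
    · obtain ⟨r, hU⟩ := U.2.2.exists_hasRad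
      obtain ⟨Y, hY, hUY, hlt⟩ := hU.exists_comp_radAdj_inf_lt hξ hnd (hU.congr h.symm) hne
      have := Submodule.finrank_lt_finrank_of_lt hlt
      exact ⟨Y, hUY, ih (hY.2.trans (hU.2.symm.trans h)) (by omega)⟩

theorem rad_eq_iff_iterate_comp_radAdj (hξ : ξ.IsAlt) (hnd : ξ.Nondegenerate) :
    rad ξ U.1 = rad ξ W.1 ↔
      ((Relation.Comp (Relation.Comp (RadAdj ξ k) (RadAdj ξ k)))^[k] Eq) U W := by
  refine ⟨fun h => iterate_comp_radAdj_of_rad_eq hξ hnd h (by omega), ?_⟩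
  suffices ∀ n, ∀ U : Tang ξ k,
      ((Relation.Comp (Relation.Comp (RadAdj ξ k) (RadAdj ξ k)))^[n] Eq) U W →
        rad ξ U.1 = rad ξ W.1 from this k U
  intro n
  induction n with
  | zero => exact fun U e => congrArg _ (congrArg _ (id e : U = W))
  | succ n ih =>
    intro U h
    rw [Function.iterate_succ_apply'] at h
    obtain ⟨Y, ⟨X, hUX, hXY⟩, hYW⟩ := h
    exact hUX.1.trans (hXY.1.trans (ih Y hYW))

end SameRadical

/-! ### Definability from adjacency -/

section Definable

variable {F V : Type*} [Field F] [AddCommGroup V] [Module F V] [FiniteDimensional F V]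
variable {ξ : LinearMap.BilinForm F V} {k : ℕ} {U W X : Tang ξ k}

theorem perp_rad_iff_rad_eq_or_exists_orthAdj (hξ : ξ.IsAlt) : Perp ξ (rad ξ X.1) W.1 ↔
    rad ξ X.1 = rad ξ W.1 ∨ ∃ Z, OrthAdj ξ k W Z ∧ rad ξ X.1 = rad ξ Z.1 := by
  obtain ⟨x, hX⟩ := X.2.2.exists_hasRad
  constructor
  · intro h
    have hx : ∀ w ∈ W.1, ξ w x = 0 := fun w hw => hξ.isRefl _ _ (h x hX.mem_rad w hw)
    by_cases hxW : x ∈ W.1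
    · exact .inl (hX.2.trans (W.2.2.hasRad hX.1 hxW hx).2.symm)
    · obtain ⟨q, hW⟩ := W.2.2.exists_hasRad
      obtain ⟨H, hH, hqH, hHW_sup⟩ := hW.exists_isRegular hξ.isRefl
      have hHW : H ≤ W.1 := hHW_sup ▸ le_sup_left
      have hd : finrank F H + 1 = k := by
        rw [← Submodule.finrank_sup_span_singleton hqH, hHW_sup, W.2.1]
      obtain ⟨Z, hZ, hZx⟩ := hH.exists_tang hξ hd hX.1 fun w hw => hx w (hHW hw)
      have hWZ : W ≠ Z := fun e => hxW (e ▸ hZx.mem)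
      exact .inr ⟨Z, ⟨botAdj_of_isRegular hH hd hHW (hZ ▸ le_sup_left) hWZ,
        (perp_rad_rad_iff hW hZx).2 (hx q hW.mem)⟩, hX.2.trans hZx.2.symm⟩
  · rintro (h | ⟨Z, hWZ, h⟩)
    · exact (perp_rad_iff hX).2 fun w hw => (hX.congr h.symm).left hξ.isRefl hw
    · exact (perp_rad_iff hX).2 fun w hw => hξ.isRefl _ _ <|
        (OrthAdj.perp_sup hξ ⟨hWZ.1.symm, (perp_comm hξ.isRefl).1 hWZ.2⟩
          (hX.congr h.symm)) w (Submodule.mem_sup_right hw)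

theorem perp_rad_rad_iff_perp_or_not_botAdj (hξ : ξ.IsAlt) : Perp ξ (rad ξ X.1) (rad ξ U.1) ↔
    Perp ξ (rad ξ X.1) U.1 ∨ ∀ Z : Tang ξ k, rad ξ Z.1 = rad ξ X.1 → ¬ BotAdj ξ k Z U := by
  obtain ⟨x, hX⟩ := X.2.2.exists_hasRad
  obtain ⟨p, hU⟩ := U.2.2.exists_hasRad
  rw [perp_rad_rad_iff hX hU, perp_rad_iff hX]
  constructor
  · refine fun hxp => or_iff_not_imp_right.2 fun hZ u hu => ?_
    push Not at hZ
    obtain ⟨Z, hZX, hZU⟩ := hZ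
    rw [← hZU.symm.inf_sup_eq hU, mem_sup_span_singleton] at hu
    obtain ⟨y, hy, t, rfl⟩ := hu
    simp [(hX.congr hZX).left hξ.isRefl hy.2, hxp]
  · rintro (h | h)
    · exact h p hU.mem
    · by_contra hxp
      have hd := finrank_inf_ker_add_one hU.mem hxp
      have hreg := hU.isRegular_of_notMem hξ.isRefl inf_le_left (fun hm => hxp hm.2) hd
      obtain ⟨Z, hZ, hZx⟩ :=
        hreg.exists_tang hξ (hd.trans U.2.1) hX.1 fun y hy => hξ.isRefl _ _ hy.2
      have hZU : Z ≠ U := fun e => hxp (hZx.left hξ.isRefl (e ▸ hU.mem))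
      exact h Z (hZx.2.trans hX.2.symm) <|
        botAdj_of_isRegular hreg (hd.trans U.2.1) (hZ ▸ le_sup_left) inf_le_left hZU

theorem definablePred_spanTriangle (hξ : ξ.IsAlt) (h2 : (2 : F) ≠ 0) (hk : 2 ≤ k) {ι : Type}
    (i j l : ι) : DefinablePred (BotAdj ξ k) fun v => SpanTriangle ξ k (v i) (v j) (v l) :=
  have adj {κ : Type} (a b : κ) : DefinablePred (BotAdj ξ k) fun v => BotAdj ξ k (v a) (v b) :=
    DefinableRel.self.app a b
  have adj₃ {κ : Type} (y a b c : κ) : DefinablePred (BotAdj ξ k) fun v =>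
      BotAdj ξ k (v y) (v a) ∧ BotAdj ξ k (v y) (v b) ∧ BotAdj ξ k (v y) (v c) :=
    (adj y a).and ((adj y b).and (adj y c))
  .congr (fun _ => spanTriangle_iff hξ h2 hk) <|
    .and ((adj i j).and ((adj l i).and (adj l j))) <| .ex <| .ex <|
    .and (adj₃ _ _ _ _) <| .and (adj₃ _ _ _ _) <| .and (DefinableRel.eq.app _ _).not (adj _ _).not

theorem definableRel_orthAdj (hξ : ξ.IsAlt) (h2 : (2 : F) ≠ 0) (hk : 2 ≤ k) :
    DefinableRel (BotAdj ξ k) (OrthAdj ξ k) :=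
  have adj {κ : Type} (a b : κ) : DefinablePred (BotAdj ξ k) fun v => BotAdj ξ k (v a) (v b) :=
    DefinableRel.self.app a b
  have triangle {κ : Type} := definablePred_spanTriangle (ι := κ) hξ h2 hk
  .congr (fun _ _ => orthAdj_iff hξ hk) <|
    DefinablePred.and (adj _ _) <| .all <| .all <| .all <|
    .imp (triangle _ _ _) <| .imp (triangle _ _ _) <| .imp (triangle _ _ _) <|
    .imp (adj _ _).not <| .imp (adj _ _).not (adj _ _).not

theorem definableRel_radAdj (hξ : ξ.IsAlt) (h2 : (2 : F) ≠ 0) (hk : 2 ≤ k) :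
    DefinableRel (BotAdj ξ k) (RadAdj ξ k) :=
  have triangle {κ : Type} := definablePred_spanTriangle (ι := κ) hξ h2 hk
  .congr (fun _ _ => radAdj_iff hξ) <|
    DefinablePred.or (DefinableRel.eq.app _ _) <| .ex <| .ex <|
    .and ((definableRel_orthAdj hξ h2 hk).app _ _) <|
    .and (triangle _ _ _) <| .and (triangle _ _ _) (DefinableRel.self.app _ _).not

theorem definableRel_rad_eq (hξ : ξ.IsAlt) (hnd : ξ.Nondegenerate) (h2 : (2 : F) ≠ 0)
    (hk : 2 ≤ k) : DefinableRel (BotAdj ξ k) fun U W => rad ξ U.1 = rad ξ W.1 :=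
  have hadj := definableRel_radAdj hξ h2 hk
  ((hadj.comp hadj).iterate_comp k).congr fun _ _ => rad_eq_iff_iterate_comp_radAdj hξ hnd

theorem definableRel_perp_rad (hξ : ξ.IsAlt) (hnd : ξ.Nondegenerate) (h2 : (2 : F) ≠ 0)
    (hk : 2 ≤ k) : DefinableRel (BotAdj ξ k) fun X W => Perp ξ (rad ξ X.1) W.1 :=
  have hrad := definableRel_rad_eq hξ hnd h2 hk
  .congr (fun _ _ => perp_rad_iff_rad_eq_or_exists_orthAdj hξ) <|
    DefinablePred.or (hrad.app _ _) <| .ex <|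
    .and ((definableRel_orthAdj hξ h2 hk).app _ _) (hrad.app _ _)

theorem definableRel_perp_rad_rad (hξ : ξ.IsAlt) (hnd : ξ.Nondegenerate) (h2 : (2 : F) ≠ 0)
    (hk : 2 ≤ k) : DefinableRel (BotAdj ξ k) fun X U => Perp ξ (rad ξ X.1) (rad ξ U.1) :=
  .congr (fun _ _ => perp_rad_rad_iff_perp_or_not_botAdj hξ) <|
    DefinablePred.or ((definableRel_perp_rad hξ hnd h2 hk).app _ _) <| .all <|
    .imp ((definableRel_rad_eq hξ hnd h2 hk).app _ _) (DefinableRel.self.app _ _).not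

end Definable

/-! ### Existence of tangential subspaces -/

section Existence

variable {F V : Type*} [Field F] [AddCommGroup V] [Module F V]
variable {ξ : LinearMap.BilinForm F V} {k : ℕ}

theorem IsRegular.sup_span_singleton_sup_span_singleton (hξ : ξ.IsAlt) {H : Submodule F V}
    (hH : IsRegular ξ H) {x y : V} (hx : ∀ z ∈ H, ξ z x = 0) (hy : ∀ z ∈ H, ξ z y = 0)
    (hxy : ξ x y ≠ 0) : IsRegular ξ (H ⊔ F ∙ x ⊔ F ∙ y) := by
  have hyx : ξ y x ≠ 0 := fun e => hxy (hξ.isRefl _ _ e)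
  have hxK : x ∈ H ⊔ F ∙ x ⊔ F ∙ y :=
    Submodule.mem_sup_left (Submodule.mem_sup_right (Submodule.mem_span_singleton_self x))
  have hyK : y ∈ H ⊔ F ∙ x ⊔ F ∙ y :=
    Submodule.mem_sup_right (Submodule.mem_span_singleton_self y)
  refine isRegular_iff.2 fun v hv hv_perp => ?_
  obtain ⟨u, hu, b, rfl⟩ := mem_sup_span_singleton.1 hv
  obtain ⟨c, hc, a, rfl⟩ := mem_sup_span_singleton.1 hu
  have hb : b = 0 := by
    simpa [hξ.isRefl _ _ (hx c hc), hξ.self_eq_zero, hxy] using hv_perp x hxK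
  have ha : a = 0 := by
    simpa [hξ.isRefl _ _ (hy c hc), hξ.self_eq_zero, hyx] using hv_perp y hyK
  have hc₀ : c = 0 := isRegular_iff.1 hH c hc fun z hz => by
    simpa [hx z hz, hy z hz] using
      hv_perp z (Submodule.mem_sup_left (Submodule.mem_sup_left hz))
  simp [ha, hb, hc₀]

variable [FiniteDimensional F V]

theorem IsRegular.exists_hyperbolic_pair (hξ : ξ.IsRefl) {H S : Submodule F V}
    (hH : IsRegular ξ H) (hHS : H ≤ S) (hd : finrank F H + finrank F (rad ξ S) < finrank F S) :
    ∃ x ∈ S, ∃ y ∈ S, (∀ z ∈ H, ξ z x = 0) ∧ (∀ z ∈ H, ξ z y = 0) ∧ ξ x y ≠ 0 := by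
  by_contra! hcon
  have hle : S ≤ H ⊔ rad ξ S := fun v hv => by
    obtain ⟨a, ha, w, hw, rfl⟩ := hH.exists_add hξ v
    have hwS : w ∈ S := (Submodule.add_mem_iff_right _ (hHS ha)).1 hv
    refine Submodule.add_mem_sup ha ⟨hwS, fun u hu => ?_⟩
    obtain ⟨b, hb, w', hw', rfl⟩ := hH.exists_add hξ u
    have hw'S : w' ∈ S := (Submodule.add_mem_iff_right _ (hHS hb)).1 hu
    simp [hw b hb, hcon w' hw'S w hwS hw' hw]
  have := Submodule.finrank_mono hle
  have := Submodule.finrank_add_le_finrank_add_finrank H (rad ξ S)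
  omega

theorem exists_isRegular_of_finrank (hξ : ξ.IsAlt) (S : Submodule F V) (j : ℕ)
    (h : 2 * j + finrank F (rad ξ S) ≤ finrank F S) :
    ∃ H ≤ S, IsRegular ξ H ∧ finrank F H = 2 * j := by
  induction j with
  | zero => exact ⟨⊥, bot_le, by simp [IsRegular, rad], by simp⟩
  | succ j ih =>
    obtain ⟨H, hHS, hH, hd⟩ := ih (by omega)
    obtain ⟨x, hx, y, hy, hxH, hyH, hxy⟩ :=
      hH.exists_hyperbolic_pair hξ.isRefl hHS (by omega)
    have hx₀ : x ≠ 0 := by rintro rfl; simp at hxy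
    have hyHx : y ∉ H ⊔ F ∙ x := fun hm => by
      obtain ⟨a, ha, t, rfl⟩ := mem_sup_span_singleton.1 hm
      exact hxy (by simp [hξ.isRefl _ _ (hxH a ha), hξ.self_eq_zero])
    refine ⟨H ⊔ F ∙ x ⊔ F ∙ y, sup_le (sup_le hHS ?_) ?_,
      hH.sup_span_singleton_sup_span_singleton hξ hxH hyH hxy, ?_⟩
    · exact (Submodule.span_singleton_le_iff_mem _ _).2 hx
    · exact (Submodule.span_singleton_le_iff_mem _ _).2 hy
    · rw [Submodule.finrank_sup_span_singleton hyHx,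
        Submodule.finrank_sup_span_singleton (hH.notMem hx₀ hxH), hd]
      ring

theorem exists_hasRad (hξ : ξ.IsAlt) (hnd : ξ.Nondegenerate) (hk : Odd k)
    (hkn : k + 1 ≤ finrank F V) {p : V} (hp : p ≠ 0) : ∃ U : Tang ξ k, HasRad ξ U.1 p := by
  obtain ⟨j, rfl⟩ := hk
  have hd := LinearMap.BilinForm.finrank_orthogonal hnd (F ∙ p)
  rw [finrank_span_singleton hp] at hd
  have hrad : finrank F (rad ξ (ξ.orthogonal (F ∙ p))) ≤ 1 := by
    rw [rad, LinearMap.BilinForm.orthogonal_orthogonal hnd hξ.isRefl,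
      ← finrank_span_singleton (K := F) hp]
    exact Submodule.finrank_mono inf_le_right
  obtain ⟨H, hH, hreg, hHd⟩ :=
    exists_isRegular_of_finrank hξ (ξ.orthogonal (F ∙ p)) j (by omega)
  obtain ⟨U, -, hU⟩ := hreg.exists_tang hξ (by rw [hHd]) hp fun y hy =>
    hξ.isRefl _ _ (hH hy p (Submodule.mem_span_singleton_self p))
  exact ⟨U, hU⟩

end Existence

/-! ### Coding of points and lines -/

section Codes

variable {F V : Type*} [Field F] [AddCommGroup V] [Module F V]
variable {ξ : LinearMap.BilinForm F V} {k : ℕ}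

theorem perp_sup_right {S T T' : Submodule F V} :
    Perp ξ S (T ⊔ T') ↔ Perp ξ S T ∧ Perp ξ S T' := by
  refine ⟨fun h => ⟨fun u hu w hw => h u hu w (Submodule.mem_sup_left hw),
    fun u hu w hw => h u hu w (Submodule.mem_sup_right hw)⟩, fun h u hu w hw => ?_⟩
  obtain ⟨x, hx, y, hy, rfl⟩ := Submodule.mem_sup.1 hw
  simp [h.1 u hu x hx, h.2 u hu y hy]

theorem perp_sup_left {S S' T : Submodule F V} :
    Perp ξ (S ⊔ S') T ↔ Perp ξ S T ∧ Perp ξ S' T := by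
  refine ⟨fun h => ⟨fun u hu => h u (Submodule.mem_sup_left hu),
    fun u hu => h u (Submodule.mem_sup_right hu)⟩, fun h u hu w hw => ?_⟩
  obtain ⟨x, hx, y, hy, rfl⟩ := Submodule.mem_sup.1 hu
  simp [h.1 x hx w hw, h.2 y hy w hw]

/-- The coding of a point by the tangential `k`-subspaces with that radical. -/
abbrev pointCoding (H : ∀ p : V, p ≠ 0 → ∃ U : Tang ξ k, HasRad ξ U.1 p) :
    Coding (Tang ξ k) (Point F V) where
  arity := 1
  dom := Set.univ
  decode x := ⟨rad ξ (x.1 0).1, (x.1 0).2.2⟩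
  surj l := by
    obtain ⟨v, hv₀, hv⟩ := exists_eq_span_singleton l.2
    obtain ⟨U, hU⟩ := H v hv₀
    exact ⟨⟨fun _ => U, trivial⟩, Subtype.ext (hU.2.trans hv.symm)⟩

variable [FiniteDimensional F V]

theorem finrank_sup_eq_two {S T : Submodule F V} (hS : finrank F S = 1) (hT : finrank F T = 1)
    (h : S ≠ T) : finrank F (S ⊔ T : Submodule F V) = 2 := by
  obtain ⟨q, -, rfl⟩ := exists_eq_span_singleton hT
  rw [Submodule.finrank_sup_span_singleton, hS]
  exact fun hq => h (Submodule.eq_of_le_of_finrank_eq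
    ((Submodule.span_singleton_le_iff_mem _ _).2 hq) (hT.trans hS.symm)).symm

theorem exists_span_singleton_sup_eq {L : Submodule F V} (h : finrank F L = 2) :
    ∃ p q : V, p ≠ 0 ∧ q ≠ 0 ∧ F ∙ p ≠ F ∙ q ∧ F ∙ p ⊔ F ∙ q = L := by
  have hL : L ≠ ⊥ := by rintro rfl; simp at h
  obtain ⟨p, hp, hp₀⟩ := Submodule.exists_mem_ne_zero_of_ne_bot hL
  have hle : F ∙ p ≤ L := (Submodule.span_singleton_le_iff_mem _ _).2 hp
  have hlt : F ∙ p < L := lt_of_le_of_ne hle fun e => by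
    rw [← e, finrank_span_singleton hp₀] at h
    omega
  obtain ⟨q, hq, hqp⟩ := Set.exists_of_ssubset hlt
  refine ⟨p, q, hp₀, by rintro rfl; exact hqp (zero_mem _), fun e => hqp ?_,
    sup_span_singleton_eq hle hq hqp (by rw [finrank_span_singleton hp₀, h])⟩
  exact e ▸ Submodule.mem_span_singleton_self q

/-- The coding of a line by the pairs of codes of distinct points on it. -/
abbrev lineCoding (H : ∀ p : V, p ≠ 0 → ∃ U : Tang ξ k, HasRad ξ U.1 p) :
    Coding (Tang ξ k) (Line F V) where
  arity := 2
  dom := {x | rad ξ (x 0).1 ≠ rad ξ (x 1).1}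
  decode x := ⟨rad ξ (x.1 0).1 ⊔ rad ξ (x.1 1).1, finrank_sup_eq_two (x.1 0).2.2 (x.1 1).2.2 x.2⟩
  surj l := by
    obtain ⟨p, q, hp₀, hq₀, hne, e⟩ := exists_span_singleton_sup_eq l.2
    obtain ⟨U, hU⟩ := H p hp₀
    obtain ⟨W, hW⟩ := H q hq₀
    exact ⟨⟨![U, W], hU.2.trans_ne (hne.trans_eq hW.2.symm)⟩,
      Subtype.ext ((congrArg₂ _ hU.2 hW.2).trans e)⟩

theorem le_iff_perp (hξ : ξ.IsRefl) (hnd : ξ.Nondegenerate)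
    (H : ∀ p : V, p ≠ 0 → ∃ U : Tang ξ k, HasRad ξ U.1 p) {S T : Submodule F V} :
    S ≤ T ↔ ∀ X : Tang ξ k, Perp ξ (rad ξ X.1) T → Perp ξ (rad ξ X.1) S := by
  refine ⟨fun h X hX u hu w hw => hX u hu w (h hw), fun h s hs => ?_⟩
  rw [← LinearMap.BilinForm.orthogonal_orthogonal hnd hξ T]
  intro x hx
  by_cases hx₀ : x = 0
  · simp [hx₀]
  obtain ⟨X, hX⟩ := H x hx₀
  exact h X ((perp_rad_iff hX).2 fun t ht => hξ _ _ (hx t ht)) x hX.mem_rad s hs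

section DefinesGeometry

variable {r : Tang ξ k → Tang ξ k → Prop} {ι : Type}

theorem definableRel_rad_le_of_perp (hξ : ξ.IsRefl) (hnd : ξ.Nondegenerate)
    (H : ∀ p : V, p ≠ 0 → ∃ U : Tang ξ k, HasRad ξ U.1 p)
    (hrad : DefinableRel r fun U W => Perp ξ (rad ξ U.1) (rad ξ W.1))
    (hperp : DefinableRel r fun U W => Perp ξ (rad ξ U.1) W.1) :
    DefinableRel r fun U W => rad ξ U.1 ≤ W.1 :=
  .congr (fun _ _ => le_iff_perp hξ hnd H) <|
    DefinablePred.all <| .imp (hperp.app _ _) (hrad.app _ _)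

theorem definableRel_rad_eq_of_perp (hξ : ξ.IsRefl) (hnd : ξ.Nondegenerate)
    (H : ∀ p : V, p ≠ 0 → ∃ U : Tang ξ k, HasRad ξ U.1 p)
    (hrad : DefinableRel r fun U W => Perp ξ (rad ξ U.1) (rad ξ W.1)) :
    DefinableRel r fun U W => rad ξ U.1 = rad ξ W.1 :=
  .congr (fun U W => (eq_iff_le_of_finrank_eq (U.2.2.trans W.2.2.symm)).trans
      (le_iff_perp hξ hnd H)) <|
    DefinablePred.all <| .imp (hrad.app _ _) (hrad.app _ _)

theorem definablePred_rad_le_sup_of_perp (hξ : ξ.IsRefl) (hnd : ξ.Nondegenerate)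
    (H : ∀ p : V, p ≠ 0 → ∃ U : Tang ξ k, HasRad ξ U.1 p)
    (hrad : DefinableRel r fun U W => Perp ξ (rad ξ U.1) (rad ξ W.1)) (i j l : ι) :
    DefinablePred r fun v => rad ξ (v i).1 ≤ rad ξ (v j).1 ⊔ rad ξ (v l).1 :=
  .congr (fun _ => (le_iff_perp hξ hnd H).trans <| forall_congr' fun _ =>
      imp_congr_left perp_sup_right) <|
    .all <| .imp (.and (hrad.app _ _) (hrad.app _ _)) (hrad.app _ _)

theorem definesGeometry_of_perp (hξ : ξ.IsRefl) (hnd : ξ.Nondegenerate)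
    (H : ∀ p : V, p ≠ 0 → ∃ U : Tang ξ k, HasRad ξ U.1 p)
    (hrad : DefinableRel r fun U W => Perp ξ (rad ξ U.1) (rad ξ W.1))
    (hle : DefinableRel r fun U W => rad ξ U.1 ≤ W.1) : DefinesGeometry ξ k r := by
  have heq := definableRel_rad_eq_of_perp hξ hnd H hrad
  have hmem {ι : Type} := definablePred_rad_le_sup_of_perp (ι := ι) hξ hnd H hrad
  have hP : DefinableIn r (pointCoding H).dom := .univ
  have hself : DefinableIn r (Coding.self (Tang ξ k)).dom := .univ
  have hL : DefinableIn r (lineCoding H).dom := (heq.app 0 1).not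
  refine ⟨pointCoding H, lineCoding H, hP, hL,
    .of_pred hP hP (heq.app (.inl 0) (.inr 0)) fun _ _ => Subtype.ext_iff,
    .of_pred hL hL ((hmem (.inl 0) (.inr 0) (.inr 1)).and (hmem (.inl 1) (.inr 0) (.inr 1)))
      fun x y => ?_,
    .of_pred hP hL (hmem (.inl 0) (.inr 0) (.inr 1)) fun _ _ => .rfl,
    .of_pred hP hP (hrad.app (.inl 0) (.inr 0)) fun _ _ => .rfl,
    .of_pred hP hL ((hrad.app (.inl 0) (.inr 0)).and (hrad.app (.inl 0) (.inr 1)))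
      fun _ _ => perp_sup_right,
    .of_pred hL hL (((hrad.app (.inl 0) (.inr 0)).and (hrad.app (.inl 0) (.inr 1))).and
      ((hrad.app (.inl 1) (.inr 0)).and (hrad.app (.inl 1) (.inr 1))))
      fun _ _ => perp_sup_left.trans (and_congr perp_sup_right perp_sup_right),
    .of_pred hP hself (hle.app (.inl 0) (.inr (0 : Fin 1))) fun _ _ => .rfl⟩
  exact Subtype.ext_iff.trans <| (eq_iff_le_of_finrank_eq
    (((lineCoding H).decode x).2.trans ((lineCoding H).decode y).2.symm)).trans sup_le_iff

end DefinesGeometry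

theorem definesGeometry_botAdj (hξ : ξ.IsAlt) (hnd : ξ.Nondegenerate) (h2 : (2 : F) ≠ 0)
    (hk : 2 ≤ k) (hodd : Odd k) (hkn : k + 1 ≤ finrank F V) :
    DefinesGeometry ξ k (BotAdj ξ k) :=
  have H _ := exists_hasRad hξ hnd hodd hkn
  have hrad := definableRel_perp_rad_rad hξ hnd h2 hk
  definesGeometry_of_perp hξ.isRefl hnd H hrad <|
    definableRel_rad_le_of_perp hξ.isRefl hnd H hrad (definableRel_perp_rad hξ hnd h2 hk)

end Codes

/-! ### Duality -/

section Duality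

variable {F V : Type*} [Field F] [AddCommGroup V] [Module F V]
variable {ξ : LinearMap.BilinForm F V} {k l : ℕ}

theorem orthogonal_sup (S T : Submodule F V) :
    ξ.orthogonal (S ⊔ T) = ξ.orthogonal S ⊓ ξ.orthogonal T := by
  refine le_antisymm (le_inf (LinearMap.BilinForm.orthogonal_le le_sup_left)
    (LinearMap.BilinForm.orthogonal_le le_sup_right)) fun x hx y hy => ?_
  obtain ⟨s, hs, t, ht, rfl⟩ := Submodule.mem_sup.1 hy
  simp [hx.1 s hs, hx.2 t ht]

theorem le_orthogonal_iff_perp {S T : Submodule F V} : S ≤ ξ.orthogonal T ↔ Perp ξ T S :=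
  ⟨fun h u hu _ hw => h hw u hu, fun h _ hw u hu => h u hu _ hw⟩

variable [FiniteDimensional F V]

theorem rad_orthogonal (hξ : ξ.IsRefl) (hnd : ξ.Nondegenerate) (U : Submodule F V) :
    rad ξ (ξ.orthogonal U) = rad ξ U := by
  rw [rad, rad, LinearMap.BilinForm.orthogonal_orthogonal hnd hξ, inf_comm]

theorem isRegular_orthogonal_iff (hξ : ξ.IsRefl) (hnd : ξ.Nondegenerate) {U : Submodule F V} :
    IsRegular ξ (ξ.orthogonal U) ↔ IsRegular ξ U := by
  rw [IsRegular, rad_orthogonal hξ hnd, IsRegular]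

/-- The orthogonal complement of a tangential subspace, which is tangential with the same
radical. -/
def Tang.orthogonal (hξ : ξ.IsRefl) (hnd : ξ.Nondegenerate) (hkl : k + l = finrank F V)
    (U : Tang ξ k) : Tang ξ l :=
  ⟨ξ.orthogonal U.1, by rw [LinearMap.BilinForm.finrank_orthogonal hnd, U.2.1]; omega,
    by rw [IsTangential, rad_orthogonal hξ hnd]; exact U.2.2⟩

theorem topAdj_iff (U W : Tang ξ k) :
    TopAdj ξ k U W ↔
      finrank F (U.1 ⊔ W.1 : Submodule F V) = k + 1 ∧ IsRegular ξ (U.1 ⊔ W.1) := by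
  constructor
  · rintro ⟨hne, B, hB, hreg, hUB, hWB⟩
    have := finrank_inf_add_one U.2.1 W.2.1 hB hUB hWB fun e => hne (Subtype.ext e)
    have := Submodule.finrank_sup_add_finrank_inf_eq U.1 W.1
    have := U.2.1
    have := W.2.1
    obtain rfl := Submodule.eq_of_le_of_finrank_eq (sup_le hUB hWB) (by omega)
    exact ⟨hB, hreg⟩
  · rintro ⟨hd, hreg⟩
    refine ⟨?_, _, hd, hreg, le_sup_left, le_sup_right⟩
    rintro rfl
    rw [sup_idem, U.2.1] at hd
    omega

theorem botAdj_orthogonal_iff (hξ : ξ.IsRefl) (hnd : ξ.Nondegenerate)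
    (hkl : k + l = finrank F V) (U W : Tang ξ k) :
    BotAdj ξ l (U.orthogonal hξ hnd hkl) (W.orthogonal hξ hnd hkl) ↔ TopAdj ξ k U W := by
  have hd := LinearMap.BilinForm.finrank_orthogonal hnd (U.1 ⊔ W.1)
  have := Submodule.finrank_le (U.1 ⊔ W.1)
  rw [topAdj_iff, BotAdj, Tang.orthogonal, Tang.orthogonal, ← orthogonal_sup,
    isRegular_orthogonal_iff hξ hnd, hd]
  refine and_congr_left fun _ => ?_
  omega

/-- Duality: complementation carries the adjacency from above of tangential `k`-subspaces to the
adjacency from below of tangential subspaces of the complementary dimension. -/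
def topAdjIsoBotAdj (hξ : ξ.IsRefl) (hnd : ξ.Nondegenerate) (hkl : k + l = finrank F V) :
    TopAdj ξ k ≃r BotAdj ξ l where
  toFun := Tang.orthogonal hξ hnd hkl
  invFun := Tang.orthogonal hξ hnd ((add_comm l k).trans hkl)
  left_inv U := Subtype.ext (LinearMap.BilinForm.orthogonal_orthogonal hnd hξ U.1)
  right_inv U := Subtype.ext (LinearMap.BilinForm.orthogonal_orthogonal hnd hξ U.1)
  map_rel_iff' := botAdj_orthogonal_iff hξ hnd hkl _ _

theorem definesGeometry_topAdj (hξ : ξ.IsAlt) (hnd : ξ.Nondegenerate) (h2 : (2 : F) ≠ 0)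
    (hodd : Odd k) (hkn : k + 2 ≤ finrank F V) :
    DefinesGeometry ξ k (TopAdj ξ k) := by
  obtain ⟨l, hkl⟩ := Nat.exists_eq_add_of_le (show k ≤ finrank F V by omega)
  let δ := topAdjIsoBotAdj hξ.isRefl hnd hkl.symm
  have hδ (U : Tang ξ k) : rad ξ (δ U).1 = rad ξ U.1 := rad_orthogonal hξ.isRefl hnd U.1
  refine definesGeometry_of_perp hξ.isRefl hnd
    (fun _ => exists_hasRad hξ hnd hodd (by omega))
    (((definableRel_perp_rad_rad hξ hnd h2 (by omega)).preimage δ).congr fun U W => ?_)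
    (((definableRel_perp_rad hξ hnd h2 (by omega)).preimage δ).congr fun U W => ?_)
  · rw [Order.Preimage, hδ, hδ]
  · rw [Order.Preimage, hδ, perp_comm hξ.isRefl, ← le_orthogonal_iff_perp]
    exact (LinearMap.BilinForm.orthogonal_orthogonal hnd hξ.isRefl W.1).symm ▸ Iff.rfl

end Duality

end SympGeom

theorem theorem4 {F V : Type*} [Field F] [AddCommGroup V] [Module F V] [FiniteDimensional F V]
    (hF : ringChar F ≠ 2) (ξ : LinearMap.BilinForm F V) (hξ : ξ.IsAlt) (hnd : ξ.Nondegenerate)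
    (k : ℕ) (hk : Odd k) (hk1 : 1 ≤ k) (hkn : k + 1 ≤ finrank F V) :
    (k ≠ 1 → SympGeom.DefinesGeometry ξ k (SympGeom.BotAdj ξ k)) ∧
    (k + 1 ≠ finrank F V → SympGeom.DefinesGeometry ξ k (SympGeom.TopAdj ξ k)) ∧
    (k ≠ 1 → ∀ f : SympGeom.Tang ξ k ≃ SympGeom.Tang ξ k,
      (∀ U W, SympGeom.BotAdj ξ k (f U) (f W) ↔ SympGeom.BotAdj ξ k U W) →
        ∃ φ : SympGeom.GeomAut ξ, φ.Induces f) ∧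
    (k + 1 ≠ finrank F V → ∀ f : SympGeom.Tang ξ k ≃ SympGeom.Tang ξ k,
      (∀ U W, SympGeom.TopAdj ξ k (f U) (f W) ↔ SympGeom.TopAdj ξ k U W) →
        ∃ φ : SympGeom.GeomAut ξ, φ.Induces f) := by
  have h2 : (2 : F) ≠ 0 := Ring.two_ne_zero hF
  have hbot (h : k ≠ 1) : SympGeom.DefinesGeometry ξ k (SympGeom.BotAdj ξ k) :=
    SympGeom.definesGeometry_botAdj hξ hnd h2 (by omega) hk hkn
  have htop (h : k + 1 ≠ finrank F V) : SympGeom.DefinesGeometry ξ k (SympGeom.TopAdj ξ k) :=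
    SympGeom.definesGeometry_topAdj hξ hnd h2 hk (by omega)
  exact ⟨hbot, htop, fun h f hf => (hbot h).exists_induces ⟨f, hf _ _⟩,
    fun h f hf => (htop h).exists_induces ⟨f, hf _ _⟩⟩
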